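/- Let $\mathrm{C}_2=\{1,-1\}$. All algebras are real, not necessarily associative, unital or commutative. A division algebra is a non-zero algebra in which left multiplication $\mathrm{L}_a$ and right multiplication $\mathrm{R}_a$ by every $a\neq0$ are bijective; morphisms of finite-dimensional division algebras are the non-zero multiplicative linear maps. For $(\alpha,\beta)\in\mathrm{C}_2\times\mathrm{C}_2$, the block $\mathscr{C}^{\alpha,\beta}$ of a full subcategory $\mathscr{C}$ of the category of 4-dimensional division algebras is the full subcategory of those $A\in\mathscr{C}$ with $\operatorname{sign}\det \mathrm{L}_a=\alpha$ and $\operatorname{sign}\det \mathrm{R}_a=\beta$ for all $a\in A\setminus\{0\}$. For $\sigma,\tau\in\mathrm{GL}_{\mathbb R}(\mathbb H)$, the isotope $\mathbb H_{\sigma,\tau}$ is the vector space $\mathbb H$ with multiplication $x\circ y=\sigma(x)\tau(y)$. Let $\mathcal Q$ be the full subcategory of all isotopes $\mathbb H_{\sigma,\tau}$, and $\mathscr P\subset\mathcal Q$ that of all $\mathbb H_{\sigma,\tau}$ with $\sigma,\tau\in\mathrm O(\mathbb H)$. Let $\mathscr A_4$ be the category of 4-dimensional absolute valued algebras, i.e.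 4-dimensional algebras equipped with a norm satisfying $\|xy\|=\|x\|\|y\|$ (these are division algebras), with the non-zero multiplicative linear maps as morphisms and with blocks $\mathscr A_4^{\alpha,\beta}$ formed according to the signs of the underlying division algebras. Let $\mathcal S$ be the set of positive definite symmetric endomorphisms of $\mathbb H$ of determinant $1$, let $K_s=\mathrm{L}_s\mathrm{R}_{s^{-1}}$ for $s\in\mathbb H^*$, let $\kappa$ be quaternion conjugation, and let $\mathscr Z$ be the groupoid of the action $$[s]\cdot(([a],[b]),(C,D))=(([K_s(a)],[K_s(b)]),(K_sCK_s^{-1},K_sDK_s^{-1}))$$ of $\mathbb H^*/\mathbb R^*$ on $(\mathbb H^*/\mathbb R^*)^2\times\mathcal S^2$: its objects are the points, and the morphisms $x\to y$ are the group elements $g$ with $g\cdot x=y$. Let $\mathscr Y\subset\mathscr Z$ be the full subcategory of the objects with $C=D=\mathbb I$, i.e. the groupoid of the action of $\mathbb H^*/\mathbb R^*$ on $(\mathbb H^*/\mathbb R^*)^2$ by simultaneous conjugation. Choose a set of representatives of norm $1$ for $\mathbb H^*/\mathbb R^*$. The functor $\mathscr H_{\alpha,\beta}:\mathscr Z\to\mathcal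 Q^{\alpha,\beta}$ sends $(([a],[b]),(C,D))$, with $a,b$ the chosen representatives, to $\mathbb H_{\sigma,\tau}$, where $$(\sigma,\tau)=\begin{cases}(\mathrm L_aC,\ \mathrm R_bD)&\text{if }(\alpha,\beta)=(1,1),\\(\mathrm R_aC\kappa,\ \mathrm R_bD)&\text{if }(\alpha,\beta)=(1,-1),\\(\mathrm L_aC,\ \mathrm L_bD\kappa)&\text{if }(\alpha,\beta)=(-1,1),\\(\mathrm L_aC\kappa,\ \mathrm R_bD\kappa)&\text{if }(\alpha,\beta)=(-1,-1),\end{cases}$$ and it sends a morphism $[s]:(([a],[b]),(C,D))\to(([a'],[b']),(C',D'))$ to $\varepsilon K_s$, where $\varepsilon=\varepsilon_1\varepsilon_2\in\{1,-1\}$ is determined by $a'=\varepsilon_1K_s(a)$ and $b'=\varepsilon_2K_s(b)$ for the chosen representatives $a,b,a',b'$. Then, for each choice of representatives and each $(\alpha,\beta)\in\mathrm{C}_2\times\mathrm{C}_2$, the functor $\mathscr H_{\alpha,\beta}$ induces an equivalence of categories $\mathscr Y\to\mathscr P^{\alpha,\beta}$. Moreover, the four blocks $\mathscr A_4^{\alpha,\beta}$,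 $(\alpha,\beta)\in\mathrm{C}_2\times\mathrm{C}_2$, of the category of 4-dimensional absolute valued algebras are equivalent to each other. -/

import Mathlib

open CategoryTheory
open scoped Quaternion

universe u

noncomputable section

/-! ### Finite-dimensional real division algebras -/

/-- A finite-dimensional real division algebra: a non-zero finite-dimensional real vector space with
a bilinear multiplication (not assumed associative, commutative or unital) such that left and right
multiplication by every non-zero element are bijective. -/
structure RealDivAlg where
  carrier : Type u
  [ring : NonUnitalNonAssocRing carrier]
  [module : Module ℝ carrier]
  [isScalarTower : IsScalarTower ℝ carrier carrier]
  [smulCommClass : SMulCommClass ℝ carrier carrier]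
  [finite : FiniteDimensional ℝ carrier]
  [nontrivial : Nontrivial carrier]
  bijective_left : ∀ a : carrier, a ≠ 0 → Function.Bijective fun x : carrier => a * x
  bijective_right : ∀ a : carrier, a ≠ 0 → Function.Bijective fun x : carrier => x * a

namespace RealDivAlg

attribute [instance] ring module isScalarTower smulCommClass finite nontrivial

/-- A morphism of division algebras: a non-zero linear multiplicative map. -/
@[ext]
structure Hom (A B : RealDivAlg.{u}) where
  toAlgHom : A.carrier →ₙₐ[ℝ] B.carrier
  ne_zero : toAlgHom ≠ 0

theorem Hom.apply_ne_zero {A B : RealDivAlg.{u}} (f : Hom A B) {x : A.carrier} (hx : x ≠ 0) :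
    f.toAlgHom x ≠ 0 := by
  intro h
  apply f.ne_zero
  ext y
  obtain ⟨z, rfl⟩ := (A.bijective_left x hx).2 y
  simp [h]

instance : Category RealDivAlg.{u} where
  Hom := Hom
  id A := ⟨NonUnitalAlgHom.id ℝ A.carrier, by
    obtain ⟨x, hx⟩ := exists_ne (0 : A.carrier)
    intro h
    exact hx (by simpa using DFunLike.congr_fun h x)⟩
  comp {A _ _} f g := ⟨g.toAlgHom.comp f.toAlgHom, by
    obtain ⟨x, hx⟩ := exists_ne (0 : A.carrier)
    intro h
    exact g.apply_ne_zero (f.apply_ne_zero hx) (by simpa using DFunLike.congr_fun h x)⟩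

/-- The full subcategory `𝒟₄^{α,β}`: the division algebras of dimension four for which
`sign (det L_a) = α` and `sign (det R_a) = β` for the non-zero elements `a`.
The group `C₂ = {1, -1}` is `ℤˣ`. -/
def block (α β : ℤˣ) : ObjectProperty RealDivAlg.{u} := fun A =>
  Module.finrank ℝ A.carrier = 4 ∧ ∀ a : A.carrier, a ≠ 0 →
    ((SignType.sign (LinearMap.det (LinearMap.mulLeft ℝ a)) : SignType) : ℤ) = α ∧
    ((SignType.sign (LinearMap.det (LinearMap.mulRight ℝ a)) : SignType) : ℤ) = β

end RealDivAlg

/-! ### Absolute valued algebras -/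

/-- A (non-zero) finite-dimensional absolute valued algebra: a finite-dimensional real algebra
equipped with a norm such that `‖xy‖ = ‖x‖‖y‖`. -/
structure AbsValAlg where
  carrier : Type u
  [ring : NonUnitalNonAssocRing carrier]
  [module : Module ℝ carrier]
  [isScalarTower : IsScalarTower ℝ carrier carrier]
  [smulCommClass : SMulCommClass ℝ carrier carrier]
  [finite : FiniteDimensional ℝ carrier]
  [nontrivial : Nontrivial carrier]
  norm : Seminorm ℝ carrier
  eq_zero_of_norm : ∀ x, norm x = 0 → x = 0
  norm_mul : ∀ x y, norm (x * y) = norm x * norm y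

namespace AbsValAlg

attribute [instance] ring module isScalarTower smulCommClass finite nontrivial

theorem eq_zero_of_mul (A : AbsValAlg.{u}) {x y : A.carrier} (h : x * y = 0) : x = 0 ∨ y = 0 := by
  have h1 := A.norm_mul x y
  rw [h, map_zero, eq_comm, mul_eq_zero] at h1
  exact h1.imp (A.eq_zero_of_norm _) (A.eq_zero_of_norm _)

/-- The underlying algebra of a finite-dimensional absolute valued algebra is a division algebra. -/
def toDivAlg (A : AbsValAlg.{u}) : RealDivAlg.{u} where
  carrier := A.carrier
  bijective_left a ha := by
    have hi : Function.Injective (LinearMap.mulLeft ℝ a) := by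
      rw [injective_iff_map_eq_zero]
      intro x hx
      exact (A.eq_zero_of_mul hx).resolve_left ha
    exact ⟨hi, LinearMap.surjective_of_injective hi⟩
  bijective_right a ha := by
    have hi : Function.Injective (LinearMap.mulRight ℝ a) := by
      rw [injective_iff_map_eq_zero]
      intro x hx
      exact (A.eq_zero_of_mul hx).resolve_right ha
    exact ⟨hi, LinearMap.surjective_of_injective hi⟩

/-- Morphisms of absolute valued algebras are the non-zero algebra morphisms
(which automatically preserve the norm). -/
instance : Category AbsValAlg.{u} :=
  inferInstanceAs (Category (InducedCategory RealDivAlg.{u} toDivAlg))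

/-- The block `𝒜₄^{α,β}` of four-dimensional absolute valued algebras. -/
def block (α β : ℤˣ) : ObjectProperty AbsValAlg.{u} := fun A =>
  RealDivAlg.block α β A.toDivAlg

end AbsValAlg

/-! ### Isotopes -/

/-- The isotope `A_{σ,τ}`: the vector space `A` with multiplication `x ∘ y = σ(x)τ(y)`. -/
def Isotope {A : Type u} [NonUnitalNonAssocRing A] [Module ℝ A] (_σ _τ : A ≃ₗ[ℝ] A) : Type u := A

namespace Isotope

variable {A : Type u} [NonUnitalNonAssocRing A] [Module ℝ A] (σ τ : A ≃ₗ[ℝ] A)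

instance : AddCommGroup (Isotope σ τ) := inferInstanceAs (AddCommGroup A)

instance : Module ℝ (Isotope σ τ) := inferInstanceAs (Module ℝ A)

/-- The identity map from `A` to its isotope. -/
def of : A ≃ₗ[ℝ] Isotope σ τ := LinearEquiv.refl ℝ A

instance : Mul (Isotope σ τ) :=
  ⟨fun x y => of σ τ (σ ((of σ τ).symm x) * τ ((of σ τ).symm y))⟩

theorem mul_def (x y : Isotope σ τ) :
    x * y = of σ τ (σ ((of σ τ).symm x) * τ ((of σ τ).symm y)) := rfl

instance : NonUnitalNonAssocRing (Isotope σ τ) where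
  left_distrib x y z := by simp [mul_def, mul_add]
  right_distrib x y z := by simp [mul_def, add_mul]
  zero_mul x := by simp [mul_def]
  mul_zero x := by simp [mul_def]

instance [IsScalarTower ℝ A A] : IsScalarTower ℝ (Isotope σ τ) (Isotope σ τ) where
  smul_assoc c x y := by simp [mul_def, smul_mul_assoc]

instance [SMulCommClass ℝ A A] : SMulCommClass ℝ (Isotope σ τ) (Isotope σ τ) where
  smul_comm c x y := by simp [mul_def, mul_smul_comm]

instance [FiniteDimensional ℝ A] : FiniteDimensional ℝ (Isotope σ τ) :=
  inferInstanceAs (FiniteDimensional ℝ A)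

instance [Nontrivial A] : Nontrivial (Isotope σ τ) := inferInstanceAs (Nontrivial A)

/-- A linear map `φ` with `φ(σ(u)τ(v)) = σ'(φ(u))τ'(φ(v))`, as a morphism of isotopes. -/
def map {σ τ σ' τ' : A ≃ₗ[ℝ] A} (φ : A →ₗ[ℝ] A)
    (hφ : ∀ u v, φ (σ u * τ v) = σ' (φ u) * τ' (φ v)) : Isotope σ τ →ₙₐ[ℝ] Isotope σ' τ' where
  toFun u := of σ' τ' (φ ((of σ τ).symm u))
  map_smul' c u := by simp
  map_zero' := by simp
  map_add' u v := by simp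
  map_mul' u v := by simp [mul_def, hφ]

end Isotope

/-- The isotope `ℍ_{σ,τ}` of Hamilton's quaternions, as a division algebra. -/
def quatIsotope (σ τ : ℍ ≃ₗ[ℝ] ℍ) : RealDivAlg.{0} where
  carrier := Isotope σ τ
  bijective_left a ha := by
    have h : σ ((Isotope.of σ τ).symm a) ≠ 0 := by simpa using ha
    exact (Isotope.of σ τ).bijective.comp ((mulLeft_bijective₀ _ h).comp
      (τ.bijective.comp (Isotope.of σ τ).symm.bijective))
  bijective_right a ha := by
    have h : τ ((Isotope.of σ τ).symm a) ≠ 0 := by simpa using ha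
    exact (Isotope.of σ τ).bijective.comp ((mulRight_bijective₀ _ h).comp
      (σ.bijective.comp (Isotope.of σ τ).symm.bijective))

/-- The block `𝒬^{α,β}` of isotopes of `ℍ`. -/
def isotopeBlock (α β : ℤˣ) : ObjectProperty RealDivAlg.{0} := fun A =>
  (∃ σ τ : ℍ ≃ₗ[ℝ] ℍ, A = quatIsotope σ τ) ∧ RealDivAlg.block α β A

/-- The block `𝒫^{α,β}` of orthogonal isotopes of `ℍ`, i.e. isotopes `ℍ_{σ,τ}` with `σ, τ` in the
orthogonal group of `ℍ`. -/
def orthIsotopeBlock (α β : ℤˣ) : ObjectProperty RealDivAlg.{0} := fun A =>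
  (∃ σ τ : ℍ ≃ₗᵢ[ℝ] ℍ, A = quatIsotope σ.toLinearEquiv τ.toLinearEquiv) ∧
    RealDivAlg.block α β A

/-! ### Quaternions -/

/-- The subgroup `ℝ*` of `ℍ*`. -/
def realUnits : Subgroup ℍˣ := (Units.map (algebraMap ℝ ℍ).toMonoidHom).range

theorem mem_realUnits {a : ℍˣ} : a ∈ realUnits ↔ ∃ c : ℝ, c ≠ 0 ∧ (a : ℍ) = c := by
  constructor
  · rintro ⟨c, rfl⟩
    exact ⟨c, c.ne_zero, rfl⟩
  · rintro ⟨c, hc, h⟩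
    exact ⟨Units.mk0 c hc, Units.ext h.symm⟩

instance : realUnits.Normal where
  conj_mem a ha g := by
    obtain ⟨c, hc, h⟩ := mem_realUnits.1 ha
    refine mem_realUnits.2 ⟨c, hc, ?_⟩
    rw [Units.val_mul, Units.val_mul, h, ← (Quaternion.coe_commutes c (g : ℍ)), mul_assoc,
      Units.mul_inv, mul_one]

/-- The group `ℍ*/ℝ*`. -/
abbrev ProjQuat : Type := ℍˣ ⧸ realUnits

/-- Left multiplication `L_a` by an invertible quaternion. -/
def leftMul (a : ℍˣ) : ℍ ≃ₗ[ℝ] ℍ where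
  toFun x := a * x
  map_add' := mul_add _
  map_smul' c x := mul_smul_comm c _ x
  invFun x := a⁻¹.1 * x
  left_inv x := by simp
  right_inv x := by simp

/-- Right multiplication `R_a` by an invertible quaternion. -/
def rightMul (a : ℍˣ) : ℍ ≃ₗ[ℝ] ℍ where
  toFun x := x * a
  map_add' x y := add_mul x y _
  map_smul' c x := smul_mul_assoc c x _
  invFun x := x * a⁻¹.1
  left_inv x := by simp
  right_inv x := by simp

/-- The natural involution `κ` of `ℍ`: quaternion conjugation, which is the identity on `ℝ1` and
minus the identity on the purely imaginary quaternions. -/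
def kappa : ℍ ≃ₗ[ℝ] ℍ where
  toFun x := star x
  map_add' := star_add
  map_smul' c x := by simp
  invFun x := star x
  left_inv := star_star
  right_inv := star_star

/-- The homomorphism `s ↦ K_s = L_s R_{s⁻¹}` on `ℍ*`. -/
def conjHom : ℍˣ →* (ℍ ≃ₗ[ℝ] ℍ) where
  toFun s := leftMul s * rightMul s⁻¹
  map_one' := by ext1 x; simp [leftMul, rightMul]
  map_mul' s t := by ext1 x; simp [leftMul, rightMul, mul_assoc]

theorem conjHom_apply (s : ℍˣ) (x : ℍ) : conjHom s x = s * x * (s⁻¹ : ℍˣ) := by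
  simp [conjHom, leftMul, rightMul, mul_assoc]

/-- The homomorphism `[s] ↦ K_s` on `ℍ*/ℝ*`. -/
def projConj : ProjQuat →* (ℍ ≃ₗ[ℝ] ℍ) :=
  QuotientGroup.lift realUnits conjHom (by
    intro a ha
    obtain ⟨c, -, h⟩ := mem_realUnits.1 ha
    ext1 x
    rw [conjHom_apply, h, Quaternion.coe_commutes, ← h, mul_assoc, Units.mul_inv, mul_one]
    rfl)

theorem projConj_mk (s : ℍˣ) (x : ℍ) :
    projConj (s : ProjQuat) x = s * x * (s⁻¹ : ℍˣ) := conjHom_apply s x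

theorem projConj_mul (g : ProjQuat) (x y : ℍ) :
    projConj g (x * y) = projConj g x * projConj g y := by
  induction g using QuotientGroup.induction_on with
  | H s => simp [projConj_mk, mul_assoc]

theorem norm_projConj (g : ProjQuat) (x : ℍ) : ‖projConj g x‖ = ‖x‖ := by
  induction g using QuotientGroup.induction_on with
  | H s =>
    have : ‖(s : ℍ)‖ ≠ 0 := by simp
    rw [projConj_mk, norm_mul, norm_mul, Units.val_inv_eq_inv_val, norm_inv]
    field_simp

theorem projConj_star (g : ProjQuat) (x : ℍ) : projConj g (star x) = star (projConj g x) := by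
  induction g using QuotientGroup.induction_on with
  | H s =>
    simp [projConj_mk, Units.val_inv_eq_inv_val, Quaternion.inv_def, mul_assoc]

theorem projConj_mul_kappa (g : ProjQuat) (x : ℍ) :
    projConj g (kappa x) = kappa (projConj g x) := projConj_star g x

/-! ### The groupoid `𝒵` and its full subcategory `𝒴` -/

/-- The set of linear endomorphisms of `ℍ` that are positive definite symmetric and have
determinant one (such endomorphisms are invertible). -/
def SPDS : Type :=
  {C : ℍ ≃ₗ[ℝ] ℍ // (C : ℍ →ₗ[ℝ] ℍ).IsSymmetric ∧ (∀ x : ℍ, x ≠ 0 → 0 < inner ℝ (C x) x) ∧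
    LinearMap.det (C : ℍ →ₗ[ℝ] ℍ) = 1}

theorem inner_projConj (g : ProjQuat) (x y : ℍ) :
    inner ℝ (projConj g x) (projConj g y) = inner ℝ x y :=
  LinearIsometry.inner_map_map (⟨(projConj g : ℍ →ₗ[ℝ] ℍ), norm_projConj g⟩ : ℍ →ₗᵢ[ℝ] ℍ) x y

/-- Conjugation `C ↦ K_s C K_s⁻¹`. -/
def SPDS.conj (g : ProjQuat) (C : SPDS) : SPDS :=
  ⟨projConj g * C.1 * (projConj g)⁻¹, by
    have key : ∀ x y : ℍ, inner ℝ ((projConj g * C.1 * (projConj g)⁻¹) x) y =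
        inner ℝ (C.1 ((projConj g)⁻¹ x)) ((projConj g)⁻¹ y) := by
      intro x y
      rw [← inner_projConj g _ ((projConj g)⁻¹ y)]
      congr 1
      exact ((projConj g).apply_symm_apply y).symm
    have key' : ∀ x y : ℍ, inner ℝ y ((projConj g * C.1 * (projConj g)⁻¹) x) =
        inner ℝ ((projConj g)⁻¹ y) (C.1 ((projConj g)⁻¹ x)) := by
      intro x y
      rw [real_inner_comm, key, real_inner_comm]
    refine ⟨fun x y => ?_, fun x hx => ?_, ?_⟩
    · exact (key x y).trans ((C.2.1 _ _).trans (key' y x).symm)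
    · rw [key]
      exact C.2.2.1 _ (by simpa using (projConj g).symm.map_ne_zero_iff.2 hx)
    · have h := LinearMap.det_conj (C.1 : ℍ →ₗ[ℝ] ℍ) (projConj g)
      rw [C.2.2.2] at h
      exact h⟩

/-- The identity of `ℍ` as an element of `SPDS`. -/
instance : One SPDS :=
  ⟨⟨1, fun _ _ => rfl, fun _ hx => real_inner_self_pos.2 hx, LinearMap.det_id⟩⟩

/-- The set `(ℍ*/ℝ*)² × SPDS²`. -/
@[ext]
structure ZPoint where
  a : ProjQuat
  b : ProjQuat
  C : SPDS
  D : SPDS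

/-- `[s] · (([a],[b]),(C,D)) = (([K_s(a)],[K_s(b)]),(K_s C K_s⁻¹, K_s D K_s⁻¹))`; note that
`[K_s(a)] = [s a s⁻¹] = [s][a][s]⁻¹`. -/
instance : MulAction ProjQuat ZPoint where
  smul g x := ⟨g * x.a * g⁻¹, g * x.b * g⁻¹, x.C.conj g, x.D.conj g⟩
  one_smul x := by
    refine ZPoint.ext ?_ ?_ (Subtype.ext ?_) (Subtype.ext ?_)
    · change 1 * x.a * 1⁻¹ = x.a
      simp
    · change 1 * x.b * 1⁻¹ = x.b
      simp
    · change projConj 1 * x.C.1 * (projConj 1)⁻¹ = x.C.1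
      simp
    · change projConj 1 * x.D.1 * (projConj 1)⁻¹ = x.D.1
      simp
  mul_smul g h x := by
    refine ZPoint.ext ?_ ?_ (Subtype.ext ?_) (Subtype.ext ?_)
    · change (g * h) * x.a * (g * h)⁻¹ = g * (h * x.a * h⁻¹) * g⁻¹
      group
    · change (g * h) * x.b * (g * h)⁻¹ = g * (h * x.b * h⁻¹) * g⁻¹
      group
    · change projConj (g * h) * x.C.1 * (projConj (g * h))⁻¹ =
        projConj g * (projConj h * x.C.1 * (projConj h)⁻¹) * (projConj g)⁻¹
      rw [map_mul]
      group
    · change projConj (g * h) * x.D.1 * (projConj (g * h))⁻¹ =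
        projConj g * (projConj h * x.D.1 * (projConj h)⁻¹) * (projConj g)⁻¹
      rw [map_mul]
      group

/-- The groupoid `𝒵` of the action of `ℍ*/ℝ*` on `(ℍ*/ℝ*)² × SPDS²`. -/
abbrev ZCat : Type := ActionCategory ProjQuat ZPoint

/-- The objects of the full subcategory `𝒴` of `𝒵`: those in `(ℍ*/ℝ*)² × {I}²`. -/
def yProp : ObjectProperty ZCat := fun x => x.back.C = 1 ∧ x.back.D = 1

/-! ### The functors `ℋ_{α,β}` -/

/-- A choice of coset representatives of norm one for `ℍ*/ℝ*`. -/
structure Representatives where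
  rep : ProjQuat → ℍˣ
  mk_rep : ∀ x, (rep x : ProjQuat) = x
  norm_rep : ∀ x, ‖(rep x : ℍ)‖ = 1

instance : Nonempty Representatives := by
  have h : ∀ x : ProjQuat, ∃ a : ℍˣ, (a : ProjQuat) = x ∧ ‖(a : ℍ)‖ = 1 := by
    intro x
    induction x using QuotientGroup.induction_on with
    | H s =>
      have hs : ‖(s : ℍ)‖ ≠ 0 := by simp
      have hc : ((‖(s : ℍ)‖⁻¹ : ℝ) : ℍ) ≠ 0 := by
        rw [← norm_ne_zero_iff, Quaternion.norm_coe]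
        simp
      refine ⟨s * Units.mk0 _ hc, ?_, ?_⟩
      · rw [eq_comm, QuotientGroup.eq, inv_mul_cancel_left]
        exact mem_realUnits.2 ⟨_, inv_ne_zero hs, rfl⟩
      · rw [Units.val_mul, Units.val_mk0, norm_mul, Quaternion.norm_coe, norm_inv, norm_norm,
          mul_inv_cancel₀ hs]
  choose f h1 h2 using h
  exact ⟨⟨f, h1, h2⟩⟩

/-- The pair `(σ, τ)` attached to `(α, β)`, `(a, b)` and `(C, D)`. -/
def sigmaTau (α β : ℤˣ) (a b : ℍˣ) (C D : ℍ ≃ₗ[ℝ] ℍ) : (ℍ ≃ₗ[ℝ] ℍ) × (ℍ ≃ₗ[ℝ] ℍ) :=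
  if α = 1 then
    if β = 1 then (leftMul a * C, rightMul b * D)
    else (rightMul a * C * kappa, rightMul b * D)
  else
    if β = 1 then (leftMul a * C, leftMul b * D * kappa)
    else (leftMul a * C * kappa, rightMul b * D * kappa)

/-- For classes with `x' = g x g⁻¹`, the representative of `x'` is `± K_g` applied to the
representative of `x`; this is the sign. -/
def repSign (r : Representatives) (g x x' : ProjQuat) : ℝ :=
  ((r.rep x' : ℍ) * (projConj g (r.rep x))⁻¹).re

theorem projConj_rep_ne_zero (r : Representatives) (g x : ProjQuat) :
    projConj g (r.rep x : ℍ) ≠ 0 := by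
  rw [← norm_ne_zero_iff, norm_projConj, r.norm_rep]
  exact one_ne_zero

theorem repSign_spec (r : Representatives) {g x x' : ProjQuat} (h : g * x * g⁻¹ = x') :
    (r.rep x' : ℍ) = repSign r g x x' • projConj g (r.rep x : ℍ) := by
  have h0 := projConj_rep_ne_zero r g x
  obtain ⟨c, hc⟩ : ∃ c : ℝ, (r.rep x' : ℍ) = c * projConj g (r.rep x : ℍ) := by
    induction g using QuotientGroup.induction_on with
    | H s =>
      have h1 : ((s * r.rep x * s⁻¹ : ℍˣ) : ProjQuat) = (r.rep x' : ProjQuat) := by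
        rw [r.mk_rep, ← h, QuotientGroup.mk_mul, QuotientGroup.mk_mul, r.mk_rep]
        rfl
      obtain ⟨c, -, hc⟩ := mem_realUnits.1 (QuotientGroup.eq.1 h1)
      refine ⟨c, ?_⟩
      rw [Quaternion.coe_commutes, projConj_mk, ← hc]
      simp [mul_assoc]
  have : repSign r g x x' = c := by
    rw [repSign, hc, mul_assoc, mul_inv_cancel₀ h0, mul_one, Quaternion.re_coe]
  rw [this, hc, Quaternion.coe_mul_eq_smul]

theorem repSign_unique (r : Representatives) {g x x' : ProjQuat} (h : g * x * g⁻¹ = x') {c : ℝ}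
    (hc : (r.rep x' : ℍ) = c • projConj g (r.rep x : ℍ)) : repSign r g x x' = c :=
  smul_left_injective ℝ (projConj_rep_ne_zero r g x) ((repSign_spec r h).symm.trans hc)

theorem repSign_mul_self (r : Representatives) {g x x' : ProjQuat} (h : g * x * g⁻¹ = x') :
    repSign r g x x' * repSign r g x x' = 1 := by
  have h1 := congrArg norm (repSign_spec r h)
  rw [norm_smul, norm_projConj, r.norm_rep, r.norm_rep, mul_one, Real.norm_eq_abs] at h1
  rw [← abs_mul_abs_self, ← h1, mul_one]

theorem repSign_one (r : Representatives) (x : ProjQuat) : repSign r 1 x x = 1 :=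
  repSign_unique r (by simp) (by simp)

theorem repSign_mul (r : Representatives) {g h x x' x'' : ProjQuat} (h1 : g * x * g⁻¹ = x')
    (h2 : h * x' * h⁻¹ = x'') :
    repSign r (h * g) x x'' = repSign r h x' x'' * repSign r g x x' := by
  refine repSign_unique r (by rw [← h2, ← h1]; group) ?_
  rw [repSign_spec r h2, repSign_spec r h1, map_smul, smul_smul, map_mul]
  rfl

/-- The algebra `ℍ_{σ,τ}` attached to an object of `𝒵`. -/
def hObj (r : Representatives) (α β : ℤˣ) (x : ZPoint) : RealDivAlg.{0} :=
  quatIsotope (sigmaTau α β (r.rep x.a) (r.rep x.b) x.C.1 x.D.1).1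
    (sigmaTau α β (r.rep x.a) (r.rep x.b) x.C.1 x.D.1).2

/-- The sign `ε` for which `ε K_g` is a morphism between the isotopes attached to `x` and `y`. -/
def hSign (r : Representatives) (g : ProjQuat) (x y : ZPoint) : ℝ :=
  repSign r g x.a y.a * repSign r g x.b y.b

theorem hSign_mul_self (r : Representatives) {g : ProjQuat} {x y : ZPoint} (h : g • x = y) :
    hSign r g x y * hSign r g x y = 1 := by
  have h1 := repSign_mul_self r (congrArg ZPoint.a h)
  have h2 := repSign_mul_self r (congrArg ZPoint.b h)
  rw [hSign, mul_mul_mul_comm, h1, h2, one_mul]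

theorem smul_C_apply {g : ProjQuat} {x y : ZPoint} (h : g • x = y) (u : ℍ) :
    y.C.1 (projConj g u) = projConj g (x.C.1 u) := by
  subst h
  change projConj g (x.C.1 ((projConj g).symm (projConj g u))) = _
  rw [LinearEquiv.symm_apply_apply]

theorem smul_D_apply {g : ProjQuat} {x y : ZPoint} (h : g • x = y) (u : ℍ) :
    y.D.1 (projConj g u) = projConj g (x.D.1 u) := by
  subst h
  change projConj g (x.D.1 ((projConj g).symm (projConj g u))) = _
  rw [LinearEquiv.symm_apply_apply]

theorem leftMul_rep_apply (r : Representatives) {g x x' : ProjQuat} (h : g * x * g⁻¹ = x') (u : ℍ) :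
    leftMul (r.rep x') (projConj g u) =
      repSign r g x x' • projConj g (leftMul (r.rep x) u) := by
  change (r.rep x' : ℍ) * projConj g u = _ • projConj g (r.rep x * u)
  rw [projConj_mul, repSign_spec r h, smul_mul_assoc]

theorem rightMul_rep_apply (r : Representatives) {g x x' : ProjQuat} (h : g * x * g⁻¹ = x')
    (u : ℍ) : rightMul (r.rep x') (projConj g u) =
      repSign r g x x' • projConj g (rightMul (r.rep x) u) := by
  change projConj g u * (r.rep x' : ℍ) = _ • projConj g (u * r.rep x)
  rw [projConj_mul, repSign_spec r h, mul_smul_comm]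

theorem sigmaTau_apply (r : Representatives) (α β : ℤˣ) {g : ProjQuat} {x y : ZPoint}
    (h : g • x = y) (u : ℍ) :
    (sigmaTau α β (r.rep y.a) (r.rep y.b) y.C.1 y.D.1).1 (projConj g u) =
      repSign r g x.a y.a •
        projConj g ((sigmaTau α β (r.rep x.a) (r.rep x.b) x.C.1 x.D.1).1 u) ∧
    (sigmaTau α β (r.rep y.a) (r.rep y.b) y.C.1 y.D.1).2 (projConj g u) =
      repSign r g x.b y.b •
        projConj g ((sigmaTau α β (r.rep x.a) (r.rep x.b) x.C.1 x.D.1).2 u) := by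
  have ha : g * x.a * g⁻¹ = y.a := congrArg ZPoint.a h
  have hb : g * x.b * g⁻¹ = y.b := congrArg ZPoint.b h
  unfold sigmaTau
  split_ifs <;> simp only [LinearEquiv.mul_apply, ← projConj_mul_kappa, smul_C_apply h,
    smul_D_apply h, leftMul_rep_apply r ha, leftMul_rep_apply r hb, rightMul_rep_apply r ha,
    rightMul_rep_apply r hb, and_self]

/-- The map `ε K_g` between the isotopes attached to `x` and `y = g • x`. -/
def hAlgHom (r : Representatives) (α β : ℤˣ) {g : ProjQuat} {x y : ZPoint} (h : g • x = y) :
    Isotope (sigmaTau α β (r.rep x.a) (r.rep x.b) x.C.1 x.D.1).1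
      (sigmaTau α β (r.rep x.a) (r.rep x.b) x.C.1 x.D.1).2 →ₙₐ[ℝ]
    Isotope (sigmaTau α β (r.rep y.a) (r.rep y.b) y.C.1 y.D.1).1
      (sigmaTau α β (r.rep y.a) (r.rep y.b) y.C.1 y.D.1).2 :=
  Isotope.map (hSign r g x y • (projConj g : ℍ →ₗ[ℝ] ℍ)) fun u v => by
    simp only [LinearMap.smul_apply, LinearEquiv.coe_coe, map_smul, projConj_mul,
      (sigmaTau_apply r α β h _).1, (sigmaTau_apply r α β h _).2, smul_mul_smul_comm,
      smul_smul]
    rw [mul_mul_mul_comm, hSign_mul_self r h, one_mul, hSign]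

/-- The morphism `ε K_g` of division algebras attached to a morphism `g` of `𝒵`. -/
def hMap (r : Representatives) (α β : ℤˣ) {g : ProjQuat} {x y : ZPoint} (h : g • x = y) :
    RealDivAlg.Hom (hObj r α β x) (hObj r α β y) where
  toAlgHom := hAlgHom r α β h
  ne_zero h0 := by
    have h1 : hSign r g x y • projConj g (1 : ℍ) = 0 :=
      congrArg (fun f : (hObj r α β x).carrier →ₙₐ[ℝ] (hObj r α β y).carrier => f (1 : ℍ)) h0
    have h2 := hSign_mul_self r h
    rcases smul_eq_zero.1 h1 with h3 | h3
    · rw [h3, zero_mul] at h2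
      exact zero_ne_one h2
    · exact one_ne_zero ((projConj g).map_eq_zero_iff.1 h3)

/-! The algebra attached to an object of `𝒵` lies in the block `(α, β)`. -/

/-- The basis `1, i, j, k` of `ℍ`. -/
def quatBasis : Module.Basis (Fin 4) ℝ ℍ := QuaternionAlgebra.basisOneIJK (-1) 0 (-1)

theorem quatBasis_repr (q : ℍ) (i : Fin 4) :
    quatBasis.repr q i = ![q.re, q.imI, q.imJ, q.imK] i := rfl

/-- The quaternion with the given coordinates. -/
def mkQuat (a b c d : ℝ) : ℍ := ⟨a, b, c, d⟩

theorem re_mkQuat (a b c d : ℝ) : (mkQuat a b c d).re = a := rfl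
theorem imI_mkQuat (a b c d : ℝ) : (mkQuat a b c d).imI = b := rfl
theorem imJ_mkQuat (a b c d : ℝ) : (mkQuat a b c d).imJ = c := rfl
theorem imK_mkQuat (a b c d : ℝ) : (mkQuat a b c d).imK = d := rfl

theorem toMatrix_quatBasis (f : ℍ →ₗ[ℝ] ℍ) (i j : Fin 4) :
    LinearMap.toMatrix quatBasis quatBasis f i j =
      (fun q : ℍ => ![q.re, q.imI, q.imJ, q.imK])
        (f (![mkQuat 1 0 0 0, mkQuat 0 1 0 0, mkQuat 0 0 1 0, mkQuat 0 0 0 1] j)) i := by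
  have h : quatBasis j =
      ![mkQuat 1 0 0 0, mkQuat 0 1 0 0, mkQuat 0 0 1 0, mkQuat 0 0 0 1] j := by
    apply quatBasis.repr.injective
    rw [Module.Basis.repr_self]
    ext k
    rw [quatBasis_repr]
    fin_cases j <;> fin_cases k <;> simp [re_mkQuat, imI_mkQuat, imJ_mkQuat, imK_mkQuat]
  rw [LinearMap.toMatrix_apply, h]
  rfl

theorem det_mulLeft_pos {a : ℍ} (ha : a ≠ 0) : 0 < LinearMap.det (LinearMap.mulLeft ℝ a) := by
  have h : LinearMap.det (LinearMap.mulLeft ℝ a) = Quaternion.normSq a ^ 2 := by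
    have hM : LinearMap.toMatrix quatBasis quatBasis (LinearMap.mulLeft ℝ a) =
        !![a.re, -a.imI, -a.imJ, -a.imK; a.imI, a.re, -a.imK, a.imJ;
          a.imJ, a.imK, a.re, -a.imI; a.imK, -a.imJ, a.imI, a.re] := by
      ext i j
      rw [toMatrix_quatBasis]
      fin_cases i <;> fin_cases j <;>
        simp [re_mkQuat, imI_mkQuat, imJ_mkQuat, imK_mkQuat]
    rw [← LinearMap.det_toMatrix quatBasis, Quaternion.normSq_def', hM]
    simp [Matrix.det_succ_row_zero, Fin.sum_univ_succ, Fin.succAbove]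
    ring
  rw [h]
  exact pow_pos (lt_of_le_of_ne Quaternion.normSq_nonneg
    (Ne.symm (Quaternion.normSq_ne_zero.2 ha))) 2

theorem det_kappa : LinearMap.det (kappa : ℍ →ₗ[ℝ] ℍ) = -1 := by
  have hM : LinearMap.toMatrix quatBasis quatBasis (kappa : ℍ →ₗ[ℝ] ℍ) =
      !![1, 0, 0, 0; 0, -1, 0, 0; 0, 0, -1, 0; 0, 0, 0, -1] := by
    ext i j
    rw [toMatrix_quatBasis]
    fin_cases i <;> fin_cases j <;>
      simp [kappa, re_mkQuat, imI_mkQuat, imJ_mkQuat, imK_mkQuat]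
  rw [← LinearMap.det_toMatrix quatBasis, hM]
  simp [Matrix.det_succ_row_zero, Fin.sum_univ_succ, Fin.succAbove]

theorem det_mulRight_pos {a : ℍ} (ha : a ≠ 0) : 0 < LinearMap.det (LinearMap.mulRight ℝ a) := by
  have h : (kappa : ℍ →ₗ[ℝ] ℍ) ∘ₗ LinearMap.mulLeft ℝ (star a) ∘ₗ (kappa : ℍ →ₗ[ℝ] ℍ) =
      LinearMap.mulRight ℝ a := by
    apply LinearMap.ext
    intro x
    change star (star a * star x) = x * a
    rw [star_mul, star_star, star_star]
  rw [← h, LinearMap.det_comp, LinearMap.det_comp, det_kappa]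
  have := det_mulLeft_pos (star_ne_zero.2 ha)
  linarith

theorem det_leftMul_pos (a : ℍˣ) : 0 < LinearMap.det (leftMul a : ℍ →ₗ[ℝ] ℍ) :=
  det_mulLeft_pos a.ne_zero

theorem det_rightMul_pos (a : ℍˣ) : 0 < LinearMap.det (rightMul a : ℍ →ₗ[ℝ] ℍ) :=
  det_mulRight_pos a.ne_zero

theorem sign_sigmaTau (α β : ℤˣ) (a b : ℍˣ) (C D : SPDS) :
    ((SignType.sign (LinearMap.det ((sigmaTau α β a b C.1 D.1).2 : ℍ →ₗ[ℝ] ℍ)) : SignType) : ℤ)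
      = α ∧
    ((SignType.sign (LinearMap.det ((sigmaTau α β a b C.1 D.1).1 : ℍ →ₗ[ℝ] ℍ)) : SignType) : ℤ)
      = β := by
  rcases Int.units_eq_one_or α with rfl | rfl <;> rcases Int.units_eq_one_or β with rfl | rfl <;>
    simp [sigmaTau, C.2.2.2, D.2.2.2, det_kappa, sign_pos (det_leftMul_pos a),
      sign_pos (det_leftMul_pos b), sign_pos (det_rightMul_pos a), sign_pos (det_rightMul_pos b),
      Left.sign_neg]

theorem block_quatIsotope {σ τ : ℍ ≃ₗ[ℝ] ℍ} {α β : ℤˣ}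
    (hα : ((SignType.sign (LinearMap.det (τ : ℍ →ₗ[ℝ] ℍ)) : SignType) : ℤ) = α)
    (hβ : ((SignType.sign (LinearMap.det (σ : ℍ →ₗ[ℝ] ℍ)) : SignType) : ℤ) = β) :
    RealDivAlg.block α β (quatIsotope σ τ) := by
  refine ⟨?_, fun a ha => ⟨?_, ?_⟩⟩
  · exact Quaternion.finrank_eq_four
  · have h0 : σ a ≠ 0 := fun h => ha (σ.map_eq_zero_iff.1 h)
    have h : LinearMap.det (LinearMap.mulLeft ℝ a) =
        LinearMap.det (LinearMap.mulLeft ℝ (σ a) ∘ₗ (τ : ℍ →ₗ[ℝ] ℍ)) := rfl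
    rw [h, LinearMap.det_comp, sign_mul, sign_pos (det_mulLeft_pos h0), one_mul, hα]
  · have h0 : τ a ≠ 0 := fun h => ha (τ.map_eq_zero_iff.1 h)
    have h : LinearMap.det (LinearMap.mulRight ℝ a) =
        LinearMap.det (LinearMap.mulRight ℝ (τ a) ∘ₗ (σ : ℍ →ₗ[ℝ] ℍ)) := rfl
    rw [h, LinearMap.det_comp, sign_mul, sign_pos (det_mulRight_pos h0), one_mul, hβ]

theorem block_hObj (r : Representatives) (α β : ℤˣ) (x : ZPoint) :
    RealDivAlg.block α β (hObj r α β x) :=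
  block_quatIsotope (sign_sigmaTau _ _ _ _ _ _).1 (sign_sigmaTau _ _ _ _ _ _).2

/-- The functor `ℋ_{α,β} : 𝒵 ⥤ 𝒬^{α,β}`. It maps `(([a],[b]),(C,D))` to `ℍ_{σ,τ}` and a morphism
`[s]` to `ε K_s`, where `ε = ±1` is the sign that makes this map multiplicative for the chosen
representatives. -/
def hFunctor (r : Representatives) (α β : ℤˣ) : ZCat ⥤ (isotopeBlock α β).FullSubcategory where
  obj x := ⟨hObj r α β x.back, ⟨_, _, rfl⟩, block_hObj r α β x.back⟩
  map {x y} f := ObjectProperty.homMk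
    (hMap r α β (g := f.val) (x := x.back) (y := y.back) f.property)
  map_id x := by
    apply ObjectProperty.hom_ext
    apply RealDivAlg.Hom.ext
    apply NonUnitalAlgHom.ext
    intro u
    change hSign r 1 x.back x.back • projConj 1 (u : ℍ) = u
    rw [hSign, repSign_one, repSign_one, map_one, one_mul, one_smul]
    rfl
  map_comp {x y z} f g := by
    apply ObjectProperty.hom_ext
    apply RealDivAlg.Hom.ext
    apply NonUnitalAlgHom.ext
    intro u
    have hf : (show ProjQuat from f.val) • x.back = y.back := f.property
    have hg : (show ProjQuat from g.val) • y.back = z.back := g.property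
    change hSign r ((show ProjQuat from g.val) * (show ProjQuat from f.val)) x.back z.back •
      projConj ((show ProjQuat from g.val) * (show ProjQuat from f.val)) (u : ℍ) =
      hSign r (show ProjQuat from g.val) y.back z.back • projConj (show ProjQuat from g.val)
        (hSign r (show ProjQuat from f.val) x.back y.back •
          projConj (show ProjQuat from f.val) (u : ℍ))
    rw [hSign, repSign_mul r (congrArg ZPoint.a hf) (congrArg ZPoint.a hg),
      repSign_mul r (congrArg ZPoint.b hf) (congrArg ZPoint.b hg), map_smul, smul_smul,
      mul_mul_mul_comm, map_mul]
    rfl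

theorem norm_sigmaTau (α β : ℤˣ) {a b : ℍˣ} (ha : ‖(a : ℍ)‖ = 1) (hb : ‖(b : ℍ)‖ = 1) (u : ℍ) :
    ‖(sigmaTau α β a b 1 1).1 u‖ = ‖u‖ ∧ ‖(sigmaTau α β a b 1 1).2 u‖ = ‖u‖ := by
  unfold sigmaTau
  split_ifs <;> simp [leftMul, rightMul, kappa, ha, hb]

/-- The functor `𝒴 ⥤ 𝒫^{α,β}` induced by `ℋ_{α,β}`: its composite with the inclusion of `𝒫^{α,β}`
is the restriction of `ℋ_{α,β}` to `𝒴`. -/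
def hFunctorY (r : Representatives) (α β : ℤˣ) :
    yProp.FullSubcategory ⥤ (orthIsotopeBlock α β).FullSubcategory :=
  (orthIsotopeBlock α β).lift (yProp.ι ⋙ hFunctor r α β ⋙ (isotopeBlock α β).ι) (by
    rintro ⟨x, hC, hD⟩
    refine ⟨⟨⟨_, fun u => (norm_sigmaTau α β (r.norm_rep x.back.a) (r.norm_rep x.back.b) u).1⟩,
      ⟨_, fun u => (norm_sigmaTau α β (r.norm_rep x.back.a) (r.norm_rep x.back.b) u).2⟩, ?_⟩,
      block_hObj r α β x.back⟩
    change hObj r α β x.back = _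
    rw [hObj, hC, hD]
    rfl)

end

-- Fullness rests on a rigidity of isotopes. If φ is injective with φ(σu·τv) = σ'(φu)·τ'(φv), then φ
-- is an automorphism of ℍ followed by left multiplication by pq, where q and p measure how far φ is
-- from intertwining σ with σ' and τ with τ' (`exists_conj_of_isotope_hom`). Automorphisms of ℍ are
-- inner, and in each of the four normal forms the intertwining relations force p and q to be
-- central, hence real (`exists_coe_of_sigmaTau_hom`); since the representatives have norm 1, both
-- are ±1. So every morphism is ±K_s with exactly the sign prescribed by ℋ (`sigmaTau_hom_eq`).
-- Faithfulness holds because K_s fixes 1 and determines s up to a real factor.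
--
-- For essential surjectivity, Cartan–Dieudonné shows that an isometry of ℍ is x ↦ axb or x ↦ ax̄b,
-- and the sign of its determinant tells which. A one-sided multiplication by a unit quaternion then
-- carries an orthogonal isotope to normal form (`exists_iso_sigmaTau`).
--
-- A four-dimensional absolute valued algebra has a Euclidean norm, by averaging over its unit ball
-- (`parallelogram_of_norm_mul`). Kaplansky's trick passes to a unital isotope, and skewness of
-- multiplication by imaginary elements identifies that isotope with ℍ (`exists_isotope_of_inner`).
-- Hence 𝒜₄^{α,β} ≃ 𝒫^{α,β} ≃ 𝒴, and 𝒴 does not depend on (α, β).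

universe v

/-! ### Automorphisms and isometries of the quaternions -/

theorem quat_eq_coe_of_commute {q : ℍ} (h : ∀ y, q * y = y * q) : q = (q.re : ℍ) := by
  have hi := h (mkQuat 0 1 0 0)
  have hj := h (mkQuat 0 0 1 0)
  have h1 := congrArg QuaternionAlgebra.imJ hi
  have h2 := congrArg QuaternionAlgebra.imK hi
  have h3 := congrArg QuaternionAlgebra.imK hj
  simp [re_mkQuat, imI_mkQuat, imJ_mkQuat, imK_mkQuat] at h1 h2 h3
  ext <;> simp <;> linarith

theorem quat_eq_smul (q : ℍ) : q = q.re • (1 : ℍ) + q.imI • mkQuat 0 1 0 0 +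
    q.imJ • mkQuat 0 0 1 0 + q.imK • mkQuat 0 0 0 1 := by
  ext <;> simp [re_mkQuat, imI_mkQuat, imJ_mkQuat, imK_mkQuat]

/-- Automorphisms of `ℍ` are inner. -/
theorem exists_eq_conj_of_map_mul (ψ : ℍ →ₗ[ℝ] ℍ) (h1 : ψ 1 = 1)
    (hm : ∀ x y, ψ (x * y) = ψ x * ψ y) : ∃ s : ℍˣ, ∀ x, ψ x = s * x * (s⁻¹ : ℍˣ) := by
  set i : ℍ := mkQuat 0 1 0 0 with hi
  set j : ℍ := mkQuat 0 0 1 0 with hj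
  set k : ℍ := mkQuat 0 0 0 1 with hk
  have hii : i * i = -1 := by ext <;> simp [hi, re_mkQuat, imI_mkQuat, imJ_mkQuat, imK_mkQuat]
  have hjj : j * j = -1 := by ext <;> simp [hj, re_mkQuat, imI_mkQuat, imJ_mkQuat, imK_mkQuat]
  have hkk : k * k = -1 := by ext <;> simp [hk, re_mkQuat, imI_mkQuat, imJ_mkQuat, imK_mkQuat]
  have hij : i * j = k := by
    ext <;> simp [hi, hj, hk, re_mkQuat, imI_mkQuat, imJ_mkQuat, imK_mkQuat]
  have hji : j * i = -k := by
    ext <;> simp [hi, hj, hk, re_mkQuat, imI_mkQuat, imJ_mkQuat, imK_mkQuat]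
  have hjk : j * k = i := by
    ext <;> simp [hi, hj, hk, re_mkQuat, imI_mkQuat, imJ_mkQuat, imK_mkQuat]
  have hkj : k * j = -i := by
    ext <;> simp [hi, hj, hk, re_mkQuat, imI_mkQuat, imJ_mkQuat, imK_mkQuat]
  have hki : k * i = j := by
    ext <;> simp [hi, hj, hk, re_mkQuat, imI_mkQuat, imJ_mkQuat, imK_mkQuat]
  have hik : i * k = -j := by
    ext <;> simp [hi, hj, hk, re_mkQuat, imI_mkQuat, imJ_mkQuat, imK_mkQuat]
  -- the average of `ψ(g) c g⁻¹` over the quaternion group intertwines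
  set S : ℍ → ℍ := fun c => c - ψ i * c * i - ψ j * c * j - ψ k * c * k with hS
  have hp : ∀ x y z, x * y = z → ψ x * ψ y = ψ z := fun x y z h => by rw [← hm, h]
  have e1 := hp _ _ _ hii
  have e2 := hp _ _ _ hij
  have e3 := hp _ _ _ hik
  have e4 := hp _ _ _ hji
  have e5 := hp _ _ _ hjj
  have e6 := hp _ _ _ hjk
  simp only [map_neg, h1] at e1 e2 e3 e4 e5 e6
  have Si : ∀ c, ψ i * S c = S c * i := by
    intro c
    simp only [hS, mul_sub, sub_mul, mul_assoc, hii, hji, hki]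
    simp only [← mul_assoc, e1, e2, e3]
    noncomm_ring
  have Sj : ∀ c, ψ j * S c = S c * j := by
    intro c
    simp only [hS, mul_sub, sub_mul, mul_assoc, hij, hjj, hkj]
    simp only [← mul_assoc, e4, e5, e6]
    noncomm_ring
  have hne : ∃ c, S c ≠ 0 := by
    by_contra! h
    -- This is the sum of `S c * c⁻¹` over c = 1, i, j, k. For imaginary g the conjugates c g⁻¹ c⁻¹
    -- cancel in pairs, so only the term g = 1 survives, four times.
    have hsum : S 1 - S i * i - S j * j - S k * k = (4 : ℕ) • (1 : ℍ) := by
      simp only [hS, sub_mul, mul_assoc, hii, hjj, hkk, hij, hji, hjk, hkj, hki, hik, one_mul,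
        mul_one, mul_neg, neg_mul]
      noncomm_ring
    rw [h, h, h, h] at hsum
    have h4 := congrArg (fun q : ℍ => q.re) hsum
    rw [nsmul_one] at h4
    simp only [Quaternion.re_natCast] at h4
    simp at h4
  obtain ⟨c, hc⟩ := hne
  refine ⟨Units.mk0 (S c) hc, fun x => ?_⟩
  rw [Units.eq_mul_inv_iff_mul_eq, Units.val_mk0]
  have hk' : ψ k = ψ i * ψ j := by rw [← hm, hij]
  have Sk : ψ k * S c = S c * k := by
    rw [hk', mul_assoc, Sj, ← mul_assoc, Si, mul_assoc, hij]
  rw [quat_eq_smul x]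
  simp only [← hi, ← hj, ← hk, map_add, map_smul, h1, add_mul, mul_add, smul_mul_assoc,
    mul_smul_comm, Si, Sj, Sk, one_mul, mul_one]

theorem inner_smul_quat (v x : ℍ) : (2 * inner ℝ v x) • (1 : ℍ) = v * star x + x * star v := by
  ext <;> simp [Quaternion.inner_def] <;> ring

/-- With u = v/‖v‖, multiplying 2⟨u,x⟩ = u x̄ + x ū by u on the right gives u x̄ u = 2⟨u,x⟩u − x,
the negative of the hyperplane reflection. -/
theorem reflection_quat (v x : ℍ) (hv : v ≠ 0) :
    (ℝ ∙ v)ᗮ.reflection x = -(‖v‖⁻¹ • v) * star x * (‖v‖⁻¹ • v) := by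
  have hn : ‖v‖ ≠ 0 := norm_ne_zero_iff.2 hv
  have h := congrArg (· * v) (inner_smul_quat v x)
  simp only [smul_mul_assoc, one_mul, add_mul, mul_assoc, Quaternion.star_mul_self,
    Quaternion.normSq_eq_norm_mul_self] at h
  rw [Submodule.reflection_orthogonal_apply, Submodule.reflection_singleton_apply]
  simp only [neg_mul, smul_mul_assoc, mul_smul_comm, mul_assoc]
  have h' : v * (star x * v) = (2 * inner ℝ v x) • v - (‖v‖ * ‖v‖) • x := by
    rw [h, ← Quaternion.coe_commutes, Quaternion.coe_mul_eq_smul, add_sub_cancel_right]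
  rw [h', smul_neg, smul_smul, smul_sub, smul_smul, smul_smul, ← Nat.cast_smul_eq_nsmul ℝ,
    smul_smul]
  congr 2
  · congr 1
    simp
    field_simp
  · rw [show ‖v‖⁻¹ * ‖v‖⁻¹ * (‖v‖ * ‖v‖) = 1 by field_simp, one_smul]

/-- An isometry of `ℍ` is of the form `x ↦ a x b` or `x ↦ a x̄ b` with unit quaternions `a`, `b`. -/
theorem exists_isometry_form (φ : ℍ ≃ₗᵢ[ℝ] ℍ) : ∃ a b : ℍ, ‖a‖ = 1 ∧ ‖b‖ = 1 ∧
    ((∀ x, φ x = a * x * b) ∨ ∀ x, φ x = a * star x * b) := by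
  -- Cartan–Dieudonné: φ is a product of hyperplane reflections, and each one exchanges the two
  -- forms. A zero vector in the list contributes the identity.
  obtain ⟨l, -, rfl⟩ := φ.reflections_generate_dim
  induction l with
  | nil => exact ⟨1, 1, by simp, by simp, Or.inl fun x => by simp⟩
  | cons v l ih =>
    obtain ⟨a, b, ha, hb, h⟩ := ih
    simp only [List.map_cons, List.prod_cons, LinearIsometryEquiv.coe_mul, Function.comp_apply]
    by_cases hv : v = 0
    · subst hv
      have h0 : ∀ y : ℍ, (ℝ ∙ (0 : ℍ))ᗮ.reflection y = y := fun y =>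
        Submodule.reflection_mem_subspace_eq_self (by simp)
      exact ⟨a, b, ha, hb, by simpa only [h0] using h⟩
    have hu : ‖‖v‖⁻¹ • v‖ = 1 := by
      rw [norm_smul, norm_inv, norm_norm, inv_mul_cancel₀ (norm_ne_zero_iff.2 hv)]
    refine ⟨-(‖v‖⁻¹ • v) * star b, star a * (‖v‖⁻¹ • v), ?_, ?_, ?_⟩
    · rw [norm_mul, norm_neg, hu, norm_star, hb, one_mul]
    · rw [norm_mul, hu, norm_star, ha, one_mul]
    · rcases h with h | h
      · right
        intro x
        rw [reflection_quat _ _ hv, h, star_mul, star_mul]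
        noncomm_ring
      · left
        intro x
        rw [reflection_quat _ _ hv, h, star_mul, star_mul, star_star]
        noncomm_ring

/-! ### Morphisms between isotopes of the quaternions -/

theorem exists_coe_of_commute {q : ℍ} (h : ∀ y, q * y = y * q) : ∃ c : ℝ, q = c :=
  ⟨_, quat_eq_coe_of_commute h⟩

/-- A morphism of isotopes of `ℍ` is the composite of an inner automorphism with a left
multiplication. -/
theorem exists_conj_of_isotope_hom {σ τ σ' τ' : ℍ ≃ₗ[ℝ] ℍ} (φ : ℍ →ₗ[ℝ] ℍ)
    (h : ∀ u v, φ (σ u * τ v) = σ' (φ u) * τ' (φ v)) (h0 : ∀ u, u ≠ 0 → φ u ≠ 0) :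
    ∃ (p q : ℍ) (g : ProjQuat), p ≠ 0 ∧ q ≠ 0 ∧ (∀ x, φ x = p * q * projConj g x) ∧
      (∀ x, σ' (φ x) * q = φ (σ x)) ∧ ∀ x, p * τ' (φ x) = φ (τ x) := by
  -- Putting τv = 1, respectively σu = 1, in `h` yields the two intertwining relations, with q and p
  -- as multiplicators.
  set p := σ' (φ (σ.symm 1)) with hp
  set q := τ' (φ (τ.symm 1)) with hq
  have hp0 : p ≠ 0 := fun hz => h0 (σ.symm 1) (by simp) (σ'.map_eq_zero_iff.1 hz)
  have hq0 : q ≠ 0 := fun hz => h0 (τ.symm 1) (by simp) (τ'.map_eq_zero_iff.1 hz)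
  have hσ : ∀ x, σ' (φ x) * q = φ (σ x) := fun x => by
    rw [hq, ← h, LinearEquiv.apply_symm_apply, mul_one]
  have hτ : ∀ x, p * τ' (φ x) = φ (τ x) := fun x => by
    rw [hp, ← h, LinearEquiv.apply_symm_apply, one_mul]
  have h1 : φ 1 = p * q := by
    rw [hp, hq, ← h, LinearEquiv.apply_symm_apply, LinearEquiv.apply_symm_apply, mul_one]
  have hpq : p * q ≠ 0 := mul_ne_zero hp0 hq0
  -- Hence x ↦ (pq)⁻¹φ(x) is unital and multiplicative, and so inner.
  have hmul : ∀ x y, φ (x * y) = φ x * (p * q)⁻¹ * φ y := by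
    intro x y
    have hx := hσ (σ.symm x)
    have hy := hτ (τ.symm y)
    rw [LinearEquiv.apply_symm_apply] at hx hy
    rw [← hx, ← hy, mul_inv_rev]
    have := h (σ.symm x) (τ.symm y)
    rw [LinearEquiv.apply_symm_apply, LinearEquiv.apply_symm_apply] at this
    rw [this]
    simp only [mul_assoc]
    rw [mul_inv_cancel_left₀ hq0, inv_mul_cancel_left₀ hp0]
  obtain ⟨s, hs⟩ := exists_eq_conj_of_map_mul (LinearMap.mulLeft ℝ (p * q)⁻¹ ∘ₗ φ)
    (by simp only [LinearMap.comp_apply, LinearMap.mulLeft_apply]; rw [h1, inv_mul_cancel₀ hpq])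
    (by
      intro x y
      simp only [LinearMap.comp_apply, LinearMap.mulLeft_apply]
      rw [hmul]
      simp only [mul_assoc])
  refine ⟨p, q, s, hp0, hq0, fun x => ?_, hσ, hτ⟩
  rw [projConj_mk, ← hs, LinearMap.comp_apply, LinearMap.mulLeft_apply, mul_inv_cancel_left₀ hpq]

/-! ### Reality of the multiplicators for normal forms -/

theorem sigmaTau_apply_one (α β : ℤˣ) (a b : ℍˣ) :
    (sigmaTau α β a b 1 1).1 1 = a ∧ (sigmaTau α β a b 1 1).2 1 = b := by
  unfold sigmaTau
  split_ifs <;> simp [leftMul, rightMul, kappa]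

theorem forall_projConj (g : ProjQuat) {P : ℍ → Prop} (h : ∀ x, P (projConj g x)) (y : ℍ) : P y := by
  simpa using h ((projConj g).symm y)

theorem projConj_one (g : ProjQuat) : projConj g (1 : ℍ) = 1 := by
  induction g using QuotientGroup.induction_on with
  | H s => simp [projConj_mk]

/-- At x = 1 the hypothesis reads cm = K(a). Substituting this into K(ax) = K(a)K(x) and cancelling
c leaves K(x)m = mK(x), and K is onto. -/
theorem commute_of_projConj_left {a c m : ℍ} {g : ProjQuat} (hc : c ≠ 0)
    (h : ∀ x, c * projConj g x * m = projConj g (a * x)) (y : ℍ) : m * y = y * m := by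
  refine forall_projConj g (P := fun y => m * y = y * m) (fun x => ?_) y
  have h1 := h 1
  have h2 := h x
  rw [projConj_one, mul_one, mul_one] at h1
  rw [projConj_mul, ← h1, mul_assoc, mul_assoc] at h2
  exact (mul_left_cancel₀ hc h2).symm

/-- Mirror image of the left version: x = 1 gives c = mK(a), and K(a) is cancelled on the right. -/
theorem commute_of_projConj_right {a c m : ℍ} {g : ProjQuat} (ha : a ≠ 0)
    (h : ∀ x, projConj g x * c = m * projConj g (x * a)) (y : ℍ) : m * y = y * m := by
  refine forall_projConj g (P := fun y => m * y = y * m) (fun x => ?_) y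
  have h1 := h 1
  have h2 := h x
  have ha0 : projConj g a ≠ 0 := fun hz => ha ((projConj g).map_eq_zero_iff.1 hz)
  rw [projConj_one, one_mul, one_mul] at h1
  rw [projConj_mul, h1, ← mul_assoc, ← mul_assoc] at h2
  exact (mul_right_cancel₀ ha0 h2).symm

theorem exists_coe_right {p q : ℍ} {d c : ℝ} (hp0 : p ≠ 0) (hd : p * q = d) (hp : p = c) :
    ∃ c' : ℝ, q = c' := by
  refine ⟨c⁻¹ * d, ?_⟩
  rw [Quaternion.coe_mul, Quaternion.coe_inv, ← hp, ← hd, inv_mul_cancel_left₀ hp0]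

theorem exists_coe_left {p q : ℍ} {d c : ℝ} (hq0 : q ≠ 0) (hd : p * q = d) (hq : q = c) :
    ∃ c' : ℝ, p = c' := by
  refine ⟨d * c⁻¹, ?_⟩
  rw [Quaternion.coe_mul, Quaternion.coe_inv, ← hq, ← hd, mul_inv_cancel_right₀ hq0]

theorem exists_coe_conj {p q : ℍ} {c : ℝ} (hq0 : q ≠ 0) (h : q⁻¹ * p * q = c) :
    ∃ c' : ℝ, p = c' := by
  refine ⟨c, ?_⟩
  rw [mul_assoc, inv_mul_eq_iff_eq_mul₀ hq0, ← Quaternion.coe_commutes] at h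
  exact mul_right_cancel₀ hq0 h

theorem exists_coe_of_star {p : ℍ} {c : ℝ} (h : star p = c) : ∃ c' : ℝ, p = c' :=
  ⟨c, by rw [← star_star p, h, Quaternion.star_coe]⟩

section

variable {a a' d p q : ℍ} {g : ProjQuat}

/-- This and the next three lemmas treat the shapes L_a, R_aκ, L_aκ, R_a of an intertwining
relation, with d standing for pq. In the shapes with κ, replacing x by x̄ removes the conjugation of
the variable and moves d̄ to the other side of K(x), so a different combination of p and q turns out
to be real. -/
theorem exists_coe_of_left (ha : a' ≠ 0) (hd : d ≠ 0)
    (h : ∀ x, a' * (d * projConj g x) * q = d * projConj g (a * x)) : ∃ c : ℝ, q = c := by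
  refine exists_coe_of_commute (commute_of_projConj_left (a := a) (c := d⁻¹ * (a' * d)) (g := g)
    (mul_ne_zero (inv_ne_zero hd) (mul_ne_zero ha hd)) fun x => ?_)
  rw [← mul_right_inj' hd, ← h]
  simp only [mul_assoc, mul_inv_cancel_left₀ hd]

theorem exists_coe_of_right_star (ha : a ≠ 0)
    (h : ∀ x, star (d * projConj g x) * a' * q = d * projConj g (star x * a)) :
    ∃ c : ℝ, d = c := by
  refine exists_coe_of_commute (commute_of_projConj_right (c := star d * (a' * q)) (g := g) ha
    fun x => ?_)
  have hx := h (star x)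
  rw [star_star] at hx
  rw [← hx, star_mul, projConj_star, star_star]
  simp only [mul_assoc]

theorem exists_coe_of_left_star (ha : a' ≠ 0) (hd : d ≠ 0)
    (h : ∀ x, a' * star (d * projConj g x) * q = d * projConj g (a * star x)) :
    ∃ c : ℝ, star d * q = c := by
  refine exists_coe_of_commute (commute_of_projConj_left (a := a) (c := d⁻¹ * a') (g := g)
    (mul_ne_zero (inv_ne_zero hd) ha) fun x => ?_)
  have hx := h (star x)
  rw [star_star] at hx
  rw [← mul_right_inj' hd, ← hx, star_mul, projConj_star, star_star]
  simp only [mul_assoc, mul_inv_cancel_left₀ hd]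

theorem exists_coe_of_right (ha : a ≠ 0) (hp : p ≠ 0) (hd : d ≠ 0)
    (h : ∀ x, p * (d * projConj g x * a') = d * projConj g (x * a)) : ∃ c : ℝ, p = c := by
  obtain ⟨c, hc⟩ := exists_coe_of_commute (q := d⁻¹ * p⁻¹ * d) (commute_of_projConj_right (a := a)
    (c := a') (g := g) ha fun x => by
      rw [mul_assoc, ← h]
      simp only [mul_assoc, inv_mul_cancel_left₀ hp, inv_mul_cancel_left₀ hd])
  obtain ⟨c', hc'⟩ := exists_coe_conj hd hc
  exact ⟨c'⁻¹, by rw [Quaternion.coe_inv, ← hc', inv_inv]⟩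

end

/-- The multiplicators of a morphism between isotopes in normal form are real. -/
theorem exists_coe_of_sigmaTau_hom {α β : ℤˣ} {a b a' b' : ℍˣ} {p q : ℍ} {g : ProjQuat}
    (hp : p ≠ 0) (hq : q ≠ 0)
    (hσ : ∀ x, (sigmaTau α β a' b' 1 1).1 (p * q * projConj g x) * q =
      p * q * projConj g ((sigmaTau α β a b 1 1).1 x))
    (hτ : ∀ x, p * (sigmaTau α β a' b' 1 1).2 (p * q * projConj g x) =
      p * q * projConj g ((sigmaTau α β a b 1 1).2 x)) :
    (∃ c : ℝ, p = c) ∧ ∃ c : ℝ, q = c := by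
  have hpq := mul_ne_zero hp hq
  rcases Int.units_eq_one_or α with rfl | rfl <;> rcases Int.units_eq_one_or β with rfl | rfl
  · exact ⟨exists_coe_of_right b.ne_zero hp hpq hτ, exists_coe_of_left a'.ne_zero hpq hσ⟩
  · obtain ⟨c, hc⟩ := exists_coe_of_right b.ne_zero hp hpq hτ
    obtain ⟨d, hd⟩ := exists_coe_of_right_star a.ne_zero hσ
    exact ⟨⟨c, hc⟩, exists_coe_right hp hd hc⟩
  · obtain ⟨c, hc⟩ := exists_coe_of_left a'.ne_zero hpq hσ
    -- The relation for τ has its multiplicator on the left; it is absorbed into the factor b', so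
    -- that the right multiplicator is 1.
    obtain ⟨d, hd⟩ := exists_coe_of_left_star (a := b) (a' := p * b') (q := 1)
      (mul_ne_zero hp b'.ne_zero) hpq
      (fun x => by rw [mul_one, mul_assoc]; exact hτ x)
    rw [mul_one] at hd
    obtain ⟨d, hd⟩ := exists_coe_of_star hd
    exact ⟨exists_coe_left hq hd hc, ⟨c, hc⟩⟩
  · obtain ⟨c, hc⟩ := exists_coe_of_left_star a'.ne_zero hpq hσ
    -- After conjugating the variable, p is leftmost on both sides and cancels, so the relation for
    -- τ gives information on q.
    obtain ⟨Q, hQ⟩ : ∃ c : ℝ, q = c := by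
      refine exists_coe_of_commute (commute_of_projConj_right (a := b)
        (c := star (p * q) * b') (g := g) b.ne_zero fun x => ?_)
      have hx : p * (star (p * q * projConj g (star x)) * b') =
        p * q * projConj g (star (star x) * b) := hτ (star x)
      rw [star_star, star_mul, projConj_star, star_star, mul_assoc p q] at hx
      rw [← mul_left_cancel₀ hp hx, mul_assoc]
    refine ⟨?_, Q, hQ⟩
    rw [star_mul] at hc
    obtain ⟨c', hc'⟩ := exists_coe_left hq hc hQ
    obtain ⟨c'', hc''⟩ := exists_coe_right (star_ne_zero.2 hq) hc' (by rw [hQ, Quaternion.star_coe])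
    exact exists_coe_of_star hc''

theorem sigmaTau_hom_eq {α β : ℤˣ} {a b a' b' : ℍˣ} (ha : ‖(a : ℍ)‖ = 1) (hb : ‖(b : ℍ)‖ = 1)
    (ha' : ‖(a' : ℍ)‖ = 1) (hb' : ‖(b' : ℍ)‖ = 1) (φ : ℍ →ₗ[ℝ] ℍ)
    (h : ∀ u v, φ ((sigmaTau α β a b 1 1).1 u * (sigmaTau α β a b 1 1).2 v) =
      (sigmaTau α β a' b' 1 1).1 (φ u) * (sigmaTau α β a' b' 1 1).2 (φ v))
    (h0 : ∀ u, u ≠ 0 → φ u ≠ 0) :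
    ∃ (g : ProjQuat) (ε₁ ε₂ : ℝ), ε₁ ≠ 0 ∧ ε₂ ≠ 0 ∧ (a' : ℍ) = ε₁ • projConj g a ∧
      (b' : ℍ) = ε₂ • projConj g b ∧ ∀ x, φ x = (ε₁ * ε₂) • projConj g x := by
  obtain ⟨p, q, g, hp, hq, hφ, hσ, hτ⟩ := exists_conj_of_isotope_hom φ h h0
  obtain ⟨⟨P, rfl⟩, ⟨Q, rfl⟩⟩ := exists_coe_of_sigmaTau_hom hp hq
    (fun x => by rw [← hφ, ← hφ, hσ]) (fun x => by rw [← hφ, ← hφ, hτ])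
  have hP : P ≠ 0 := by rintro rfl; simp at hp
  have hQ : Q ≠ 0 := by rintro rfl; simp at hq
  have hφ' : ∀ x, φ x = (P * Q) • projConj g x := fun x => by
    rw [hφ, ← Quaternion.coe_mul, Quaternion.coe_mul_eq_smul]
  -- All four normal forms send 1 to a and to b respectively, so the relations at 1 compare a' with
  -- K(a) and b' with K(b).
  have h1 := hσ 1
  have h2 := hτ 1
  rw [hφ' 1, projConj_one, map_smul, (sigmaTau_apply_one _ _ _ _).1,
    (sigmaTau_apply_one _ _ _ _).1, hφ', ← Quaternion.coe_commutes, Quaternion.coe_mul_eq_smul,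
    smul_comm] at h1
  rw [hφ' 1, projConj_one, map_smul, (sigmaTau_apply_one _ _ _ _).2,
    (sigmaTau_apply_one _ _ _ _).2, hφ', Quaternion.coe_mul_eq_smul, smul_comm] at h2
  have h1 := smul_right_injective _ (mul_ne_zero hP hQ) h1
  have h2 := smul_right_injective _ (mul_ne_zero hP hQ) h2
  have n1 := congrArg norm h1
  have n2 := congrArg norm h2
  simp only [norm_smul, norm_projConj, ha, hb, ha', hb', mul_one, Real.norm_eq_abs] at n1 n2
  -- Since Q and P are their own inverses, they are the required ε₁ and ε₂.
  have e1 : Q * Q = 1 := by rw [← abs_mul_abs_self, n1, one_mul]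
  have e2 : P * P = 1 := by rw [← abs_mul_abs_self, n2, one_mul]
  refine ⟨g, Q, P, hQ, hP, ?_, ?_, fun x => ?_⟩
  · rw [← h1, smul_smul, e1, one_smul]
  · rw [← h2, smul_smul, e2, one_smul]
  · rw [hφ', mul_comm]

/-! ### The functor from `𝒴` is an equivalence -/

/-- If K_s is trivial, then s is central in ℍ, hence real. -/
theorem projConj_injective : Function.Injective projConj := by
  rw [injective_iff_map_eq_one]
  intro g hg
  induction g using QuotientGroup.induction_on with
  | H s =>
    rw [QuotientGroup.eq_one_iff, mem_realUnits]
    obtain ⟨c, hc⟩ := exists_coe_of_commute (q := (s : ℍ)) fun y => by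
      have h := projConj_mk s y
      rw [hg, LinearEquiv.coe_one, id, Units.eq_mul_inv_iff_mul_eq] at h
      exact h.symm
    refine ⟨c, ?_, hc⟩
    rintro rfl
    simp at hc

/-- Real factors vanish in ℍ*/ℝ*, so a relation between representatives becomes the condition for g
to be a morphism of 𝒵. -/
theorem mk_eq_conj {a a' : ℍˣ} {g : ProjQuat} {ε : ℝ} (hε : ε ≠ 0)
    (h : (a' : ℍ) = ε • projConj g a) : (a' : ProjQuat) = g * a * g⁻¹ := by
  induction g using QuotientGroup.induction_on with
  | H s =>
    change (a' : ProjQuat) = ((s * a * s⁻¹ : ℍˣ) : ProjQuat)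
    rw [eq_comm, QuotientGroup.eq, mem_realUnits]
    refine ⟨ε, hε, ?_⟩
    rw [Units.val_mul, h, projConj_mk, mul_smul_comm]
    simp [← mul_assoc, ← Quaternion.coe_mul_eq_smul]

instance hFunctorY_faithful (r : Representatives) (α β : ℤˣ) : (hFunctorY r α β).Faithful where
  map_injective {x y} f f' h := by
    apply ObjectProperty.hom_ext
    apply Subtype.ext
    set g : ProjQuat := f.hom.val with hg
    set g' : ProjQuat := f'.hom.val with hg'
    have h1 : ∀ u : ℍ, hSign r g x.obj.back y.obj.back • projConj g u =
        hSign r g' x.obj.back y.obj.back • projConj g' u := fun u =>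
      congrArg (fun k => k.hom.toAlgHom u) h
    -- K fixes 1, so the value at 1 is the sign; once the signs agree they cancel.
    have h2 := h1 1
    rw [projConj_one, projConj_one] at h2
    have h3 := smul_left_injective ℝ (one_ne_zero (α := ℍ)) h2
    have h4 := hSign_mul_self r (g := g) (x := x.obj.back) (y := y.obj.back) f.hom.property
    have h5 : hSign r g x.obj.back y.obj.back ≠ 0 := left_ne_zero_of_mul_eq_one h4
    apply projConj_injective
    ext1 u
    have := h1 u
    rw [← h3] at this
    exact smul_right_injective _ h5 this

instance hFunctorY_full (r : Representatives) (α β : ℤˣ) : (hFunctorY r α β).Full where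
  map_surjective {x y} f := by
    obtain ⟨⟨⟨⟩, ⟨a, b, C, D⟩⟩, hC, hD⟩ := x
    obtain ⟨⟨⟨⟩, ⟨a', b', C', D'⟩⟩, hC', hD'⟩ := y
    change C = 1 at hC
    change D = 1 at hD
    change C' = 1 at hC'
    change D' = 1 at hD'
    subst hC hD hC' hD'
    let F : (hObj r α β ⟨a, b, 1, 1⟩).carrier →ₙₐ[ℝ] (hObj r α β ⟨a', b', 1, 1⟩).carrier :=
      f.hom.toAlgHom
    let φ : ℍ →ₗ[ℝ] ℍ :=
      { toFun := fun u => F u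
        map_add' := fun u v => map_add F u v
        map_smul' := fun c u => map_smul F c u }
    obtain ⟨g, ε₁, ε₂, h₁, h₂, ha, hb, hφ⟩ := sigmaTau_hom_eq (α := α) (β := β)
      (r.norm_rep a) (r.norm_rep b) (r.norm_rep a') (r.norm_rep b') φ
      F.map_mul' (fun u hu => f.hom.apply_ne_zero hu)
    have ea := mk_eq_conj h₁ ha
    have eb := mk_eq_conj h₂ hb
    rw [r.mk_rep, r.mk_rep] at ea eb
    -- The pair (I, I) is fixed by the action, so only the classes of a and b constrain g.
    have hconj : ∀ g, SPDS.conj g 1 = 1 := fun g => by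
      apply Subtype.ext
      change projConj g * 1 * (projConj g)⁻¹ = 1
      group
    have hg : g • (⟨a, b, 1, 1⟩ : ZPoint) = ⟨a', b', 1, 1⟩ :=
      ZPoint.ext ea.symm eb.symm (hconj g) (hconj g)
    refine ⟨ObjectProperty.homMk ⟨g, hg⟩, ?_⟩
    apply ObjectProperty.hom_ext
    apply RealDivAlg.Hom.ext
    apply NonUnitalAlgHom.ext
    intro (u : ℍ)
    change hSign r g ⟨a, b, 1, 1⟩ ⟨a', b', 1, 1⟩ • projConj g u = φ u
    rw [hφ, hSign, repSign_unique r ea.symm ha, repSign_unique r eb.symm hb]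

/-- A multiplicative linear equivalence, as an isomorphism of division algebras. -/
def RealDivAlg.isoOfLinearEquiv {A B : RealDivAlg.{u}} (e : A.carrier ≃ₗ[ℝ] B.carrier)
    (h : ∀ x y, e (x * y) = e x * e y) : A ≅ B where
  hom := ⟨{ toFun := e, map_smul' := e.map_smul, map_zero' := e.map_zero, map_add' := e.map_add,
            map_mul' := h }, by
    obtain ⟨x, hx⟩ := exists_ne (0 : A.carrier)
    intro h0
    exact hx (e.map_eq_zero_iff.1 (DFunLike.congr_fun h0 x))⟩
  inv := ⟨{ toFun := e.symm, map_smul' := e.symm.map_smul, map_zero' := e.symm.map_zero,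
            map_add' := e.symm.map_add,
            map_mul' := fun x y => e.injective (by simp [h]) }, by
    obtain ⟨x, hx⟩ := exists_ne (0 : B.carrier)
    intro h0
    exact hx (e.symm.map_eq_zero_iff.1 (DFunLike.congr_fun h0 x))⟩
  hom_inv_id := by
    apply RealDivAlg.Hom.ext
    apply NonUnitalAlgHom.ext
    intro u
    exact e.symm_apply_apply u
  inv_hom_id := by
    apply RealDivAlg.Hom.ext
    apply NonUnitalAlgHom.ext
    intro u
    exact e.apply_symm_apply u

/-- A linear equivalence `e` with `e(σ(u)τ(v)) = σ'(e(u))τ'(e(v))`, as an isomorphism of isotopes. -/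
def quatIsotopeIso {σ τ σ' τ' : ℍ ≃ₗ[ℝ] ℍ} (e : ℍ ≃ₗ[ℝ] ℍ)
    (h : ∀ u v, e (σ u * τ v) = σ' (e u) * τ' (e v)) : quatIsotope σ τ ≅ quatIsotope σ' τ' :=
  RealDivAlg.isoOfLinearEquiv (A := quatIsotope σ τ) (B := quatIsotope σ' τ') e h

/-- In the isotope, L_x is quaternion multiplication by σ(x) after τ, and R_x is multiplication by
τ(x) after σ. Quaternion multiplications have positive determinant, so α is the sign of τ and β that
of σ, and x = 1 suffices to read them off. -/
theorem sign_det_of_block {σ τ : ℍ ≃ₗ[ℝ] ℍ} {α β : ℤˣ}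
    (h : RealDivAlg.block α β (quatIsotope σ τ)) :
    ((SignType.sign (LinearMap.det (τ : ℍ →ₗ[ℝ] ℍ)) : SignType) : ℤ) = α ∧
    ((SignType.sign (LinearMap.det (σ : ℍ →ₗ[ℝ] ℍ)) : SignType) : ℤ) = β := by
  obtain ⟨h1, h2⟩ := h.2 (1 : ℍ) (one_ne_zero (α := ℍ))
  have e1 : LinearMap.det (LinearMap.mulLeft ℝ (A := (quatIsotope σ τ).carrier) (1 : ℍ)) =
      LinearMap.det (LinearMap.mulLeft ℝ (σ 1) ∘ₗ (τ : ℍ →ₗ[ℝ] ℍ)) := rfl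
  have e2 : LinearMap.det (LinearMap.mulRight ℝ (A := (quatIsotope σ τ).carrier) (1 : ℍ)) =
      LinearMap.det (LinearMap.mulRight ℝ (τ 1) ∘ₗ (σ : ℍ →ₗ[ℝ] ℍ)) := rfl
  rw [e1, LinearMap.det_comp, sign_mul, sign_pos (det_mulLeft_pos (by simp)), one_mul] at h1
  rw [e2, LinearMap.det_comp, sign_mul, sign_pos (det_mulRight_pos (by simp)), one_mul] at h2
  exact ⟨h1, h2⟩

/-- L_a and R_b have positive determinant while det κ = −1, so the sign decides between the two
forms of an isometry. -/
theorem isometry_eq_of_sign_det {φ : ℍ ≃ₗᵢ[ℝ] ℍ} {γ : ℤˣ}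
    (h : ((SignType.sign (LinearMap.det (φ.toLinearEquiv : ℍ →ₗ[ℝ] ℍ)) : SignType) : ℤ) = γ) :
    ∃ a b : ℍˣ, ‖(a : ℍ)‖ = 1 ∧ ‖(b : ℍ)‖ = 1 ∧
      ∀ x, φ x = if γ = 1 then a * x * b else a * star x * b := by
  obtain ⟨a, b, ha, hb, hφ⟩ := exists_isometry_form φ
  have ha0 : a ≠ 0 := norm_ne_zero_iff.1 (by rw [ha]; exact one_ne_zero)
  have hb0 : b ≠ 0 := norm_ne_zero_iff.1 (by rw [hb]; exact one_ne_zero)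
  lift a to ℍˣ using isUnit_iff_ne_zero.2 ha0
  lift b to ℍˣ using isUnit_iff_ne_zero.2 hb0
  refine ⟨a, b, ha, hb, ?_⟩
  rcases hφ with hφ | hφ
  · have e : (φ.toLinearEquiv : ℍ →ₗ[ℝ] ℍ) =
        (rightMul b : ℍ →ₗ[ℝ] ℍ) ∘ₗ (leftMul a : ℍ →ₗ[ℝ] ℍ) := LinearMap.ext hφ
    rw [e, LinearMap.det_comp, sign_pos (mul_pos (det_rightMul_pos b) (det_leftMul_pos a))] at h
    have hγ : γ = 1 := Units.ext h.symm
    simpa [hγ] using hφ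
  · have e : (φ.toLinearEquiv : ℍ →ₗ[ℝ] ℍ) =
        (rightMul b : ℍ →ₗ[ℝ] ℍ) ∘ₗ (leftMul a : ℍ →ₗ[ℝ] ℍ) ∘ₗ (kappa : ℍ →ₗ[ℝ] ℍ) :=
      LinearMap.ext hφ
    rw [e, LinearMap.det_comp, LinearMap.det_comp, det_kappa, sign_mul, sign_mul,
      sign_pos (det_rightMul_pos b), sign_pos (det_leftMul_pos a)] at h
    have hγ : γ = -1 := Units.ext (by rw [← h]; simp)
    simpa [hγ] using hφ

/-- Orthogonal isotopes of `ℍ` can be brought into normal form. -/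
theorem exists_iso_sigmaTau {σ τ : ℍ ≃ₗᵢ[ℝ] ℍ} {α β : ℤˣ}
    (h : RealDivAlg.block α β (quatIsotope σ.toLinearEquiv τ.toLinearEquiv)) :
    ∃ a b : ℍˣ, ‖(a : ℍ)‖ = 1 ∧ ‖(b : ℍ)‖ = 1 ∧
      Nonempty (quatIsotope (sigmaTau α β a b 1 1).1 (sigmaTau α β a b 1 1).2 ≅
        quatIsotope σ.toLinearEquiv τ.toLinearEquiv) := by
  obtain ⟨hτ, hσ⟩ := sign_det_of_block h
  obtain ⟨a, b, ha, hb, hσ⟩ := isometry_eq_of_sign_det hσ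
  obtain ⟨c, d, hc, hd, hτ⟩ := isometry_eq_of_sign_det hτ
  have hsa : ∀ z : ℍ, star (a : ℍ) * (a * z) = z := fun z => by
    rw [← mul_assoc, Quaternion.star_mul_self, Quaternion.normSq_eq_norm_mul_self, ha]; simp
  have hds : ∀ z : ℍ, (d : ℍ) * (star (d : ℍ) * z) = z := fun z => by
    rw [← mul_assoc, Quaternion.self_mul_star, Quaternion.normSq_eq_norm_mul_self, hd]; simp
  -- In σ(u)τ(v) the surplus factors are shifted by a one-sided multiplication: by bc or its
  -- conjugate when α = β, by ā when (α, β) = (1, −1), by d̄ when (α, β) = (−1, 1). The new a and b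
  -- are what remains.
  rcases Int.units_eq_one_or α with rfl | rfl <;> rcases Int.units_eq_one_or β with rfl | rfl
  · refine ⟨a, (b * c)⁻¹ * d * (b * c), ha, by simp [hb, hc, hd],
      ⟨(quatIsotopeIso (rightMul (b * c)) fun u v => ?_).symm⟩⟩
    simp [sigmaTau, leftMul, rightMul, hσ, hτ, mul_assoc]
  · refine ⟨b * c, a * d * star a, by simp [hb, hc], by simp [ha, hd],
      ⟨(quatIsotopeIso (rightMul (star a)) fun u v => ?_).symm⟩⟩
    simp [sigmaTau, rightMul, kappa, hσ, hτ, mul_assoc, hsa]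
  · refine ⟨star d * a * d, b * c, by simp [ha, hd], by simp [hb, hc],
      ⟨(quatIsotopeIso (leftMul (star d)) fun u v => ?_).symm⟩⟩
    simp [sigmaTau, leftMul, kappa, hσ, hτ, mul_assoc, hds]
  · refine ⟨a * (b * c)⁻¹, d * star (b * c), by simp [ha, hb, hc], by simp [hb, hc, hd],
      ⟨(quatIsotopeIso (rightMul (star (b * c))) fun u v => ?_).symm⟩⟩
    simp [sigmaTau, leftMul, rightMul, kappa, hσ, hτ, mul_assoc]

theorem exists_eq_smul_rep (r : Representatives) {a : ℍˣ} (ha : ‖(a : ℍ)‖ = 1) :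
    ∃ ε : ℝ, ε * ε = 1 ∧ (r.rep (a : ProjQuat) : ℍ) = ε • (a : ℍ) := by
  have h : ((r.rep (a : ProjQuat) : ℍˣ) : ProjQuat) = a := r.mk_rep _
  obtain ⟨c, -, hc⟩ := mem_realUnits.1 (QuotientGroup.eq.1 h.symm)
  have h1 : (r.rep (a : ProjQuat) : ℍ) = c • (a : ℍ) := by
    rw [← Quaternion.coe_mul_eq_smul, Quaternion.coe_commutes, ← hc]
    simp
  refine ⟨c, ?_, h1⟩
  have h2 := congrArg norm h1
  rw [norm_smul, r.norm_rep, ha, mul_one, Real.norm_eq_abs] at h2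
  rw [← abs_mul_abs_self, ← h2, mul_one]

theorem sigmaTau_smul (α β : ℤˣ) {a b a' b' : ℍˣ} {ε₁ ε₂ : ℝ} (ha : (a' : ℍ) = ε₁ • (a : ℍ))
    (hb : (b' : ℍ) = ε₂ • (b : ℍ)) (u : ℍ) :
    (sigmaTau α β a' b' 1 1).1 u = ε₁ • (sigmaTau α β a b 1 1).1 u ∧
      (sigmaTau α β a' b' 1 1).2 u = ε₂ • (sigmaTau α β a b 1 1).2 u := by
  unfold sigmaTau
  split_ifs <;> simp [leftMul, rightMul, ha, hb]

/-- The normal form depends only on the classes of `a` and `b`, up to isomorphism. -/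
theorem nonempty_hObj_iso (r : Representatives) (α β : ℤˣ) {a b : ℍˣ} (ha : ‖(a : ℍ)‖ = 1)
    (hb : ‖(b : ℍ)‖ = 1) : Nonempty (hObj r α β ⟨a, b, 1, 1⟩ ≅
      quatIsotope (sigmaTau α β a b 1 1).1 (sigmaTau α β a b 1 1).2) := by
  obtain ⟨ε₁, h₁, ha'⟩ := exists_eq_smul_rep r ha
  obtain ⟨ε₂, h₂, hb'⟩ := exists_eq_smul_rep r hb
  have hε : (ε₁ * ε₂) * (ε₁ * ε₂) = 1 := by rw [mul_mul_mul_comm, h₁, h₂, one_mul]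
  -- A real scalar μ ≠ 0 is multiplicative here exactly when μ = μ²ε₁ε₂, that is, when μ = ε₁ε₂.
  refine ⟨(quatIsotopeIso (LinearEquiv.smulOfNeZero ℝ ℍ (ε₁ * ε₂)
    (left_ne_zero_of_mul_eq_one hε)) fun u v => ?_).symm⟩
  change (ε₁ * ε₂) • _ = (sigmaTau α β (r.rep a) (r.rep b) 1 1).1 ((ε₁ * ε₂) • u) *
    (sigmaTau α β (r.rep a) (r.rep b) 1 1).2 ((ε₁ * ε₂) • v)
  rw [map_smul, map_smul, (sigmaTau_smul α β ha' hb' _).1, (sigmaTau_smul α β ha' hb' _).2,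
    smul_mul_smul_comm, smul_mul_smul_comm, hε, one_smul]

instance hFunctorY_essSurj (r : Representatives) (α β : ℤˣ) : (hFunctorY r α β).EssSurj where
  mem_essImage := by
    rintro ⟨A, ⟨σ, τ, rfl⟩, h⟩
    obtain ⟨a, b, ha, hb, ⟨i⟩⟩ := exists_iso_sigmaTau h
    obtain ⟨j⟩ := nonempty_hObj_iso r α β ha hb
    exact ⟨⟨⟨(), ⟨a, b, 1, 1⟩⟩, rfl, rfl⟩, ⟨ObjectProperty.isoMk _ (j ≪≫ i)⟩⟩

theorem hFunctorY_isEquivalence (r : Representatives) (α β : ℤˣ) :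
    (hFunctorY r α β).IsEquivalence where

/-! ### Absolute valued algebras of dimension four -/

section

open MeasureTheory

variable {V : Type*} [NormedAddCommGroup V] [NormedSpace ℝ V] [FiniteDimensional ℝ V]

/-- In a finite-dimensional absolute valued algebra, left multiplication by an element of norm one
is an isometry. -/
noncomputable def mulIsometry (m : V →ₗ[ℝ] V →ₗ[ℝ] V) (hm : ∀ x y, ‖m x y‖ = ‖x‖ * ‖y‖) (a : V) (ha : ‖a‖ = 1) :
    V ≃ₗᵢ[ℝ] V :=
  LinearIsometry.toLinearIsometryEquiv
    (⟨m a, fun x => by rw [hm, ha, one_mul]⟩ : V →ₗᵢ[ℝ] V) rfl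

/-- The norm of a finite-dimensional absolute valued algebra is Euclidean: up to a constant, its
square is the average over the unit ball of the squares `‖yx‖²` for an auxiliary Euclidean norm. -/
theorem parallelogram_of_norm_mul (m : V →ₗ[ℝ] V →ₗ[ℝ] V) (hm : ∀ x y, ‖m x y‖ = ‖x‖ * ‖y‖)
    (x y : V) : ‖x + y‖ * ‖x + y‖ + ‖x - y‖ * ‖x - y‖ = 2 * (‖x‖ * ‖x‖ + ‖y‖ * ‖y‖) := by
  rcases subsingleton_or_nontrivial V with hV | hV
  · simp [Subsingleton.elim x 0, Subsingleton.elim y 0]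
  borelize V
  -- Hausdorff measure for the given norm is preserved by every isometry of that norm; in top
  -- dimension it is also finite on compact sets and positive on non-empty open sets.
  let ν : Measure V := μH[Module.finrank ℝ V]
  let N : V → ℝ := fun z => ‖toEuclidean z‖ ^ 2
  let B : Set V := Metric.closedBall 0 1
  have hN : Continuous N := by fun_prop
  have hint : ∀ f : V → V, Continuous f → IntegrableOn (fun z => N (f z)) B ν := fun f hf =>
    (hN.comp hf).continuousOn.integrableOn_compact (isCompact_closedBall 0 1)
  have hmc : ∀ y, Continuous fun z => m y z := fun y => (m y).continuous_of_finiteDimensional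
  let c : ℝ := ∫ z in B, N z ∂ν
  have hc : 0 < c := by
    refine (setIntegral_pos_iff_support_of_nonneg_ae (ae_of_all _ fun z => by positivity)
      (hint id continuous_id)).2 ?_
    obtain ⟨v, hv⟩ := exists_ne (0 : V)
    have ho : IsOpen (Metric.ball (0 : V) 1 ∩ {0}ᶜ) :=
      Metric.isOpen_ball.inter isOpen_compl_singleton
    refine (ho.measure_pos ν ⟨(2 * ‖v‖)⁻¹ • v, ?_, ?_⟩).trans_le (measure_mono ?_)
    · have : ‖v‖ ≠ 0 := norm_ne_zero_iff.2 hv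
      rw [mem_ball_zero_iff, norm_smul, norm_inv, norm_mul, norm_norm]
      field_simp
      norm_num
    · simp [hv]
    · rintro z ⟨hz, hz0⟩
      refine ⟨?_, Metric.ball_subset_closedBall hz⟩
      simpa [N] using hz0
  -- Left multiplication by a unit vector preserves both the ball and the measure, so the average
  -- does not depend on y.
  have hunit : ∀ y, ‖y‖ = 1 → ∫ z in B, N (m y z) ∂ν = c := by
    intro y hy
    let e := mulIsometry m hm y hy
    have hp : MeasurePreserving e ν ν :=
      e.toIsometryEquiv.measurePreserving_hausdorffMeasure _
    have hB : e ⁻¹' B = B := by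
      ext z
      simp [B]
    have := hp.setIntegral_preimage_emb e.toHomeomorph.measurableEmbedding N B
    rw [hB] at this
    exact this
  have hQ : ∀ y, ∫ z in B, N (m y z) ∂ν = ‖y‖ * ‖y‖ * c := by
    intro y
    rcases eq_or_ne y 0 with rfl | hy
    · simp [N]
    have hy0 : ‖y‖ ≠ 0 := norm_ne_zero_iff.2 hy
    have h1 := hunit (‖y‖⁻¹ • y) (by rw [norm_smul, norm_inv, norm_norm, inv_mul_cancel₀ hy0])
    rw [← h1, ← integral_const_mul]
    congr 1
    ext z
    simp only [N, map_smul, LinearMap.smul_apply, norm_smul, norm_inv, norm_norm]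
    field_simp
  -- The parallelogram law holds pointwise for the auxiliary Euclidean norm; integrating it gives c
  -- times the law for the given norm.
  have hpar : ∀ z, N (m (x + y) z) + N (m (x - y) z) = 2 * N (m x z) + 2 * N (m y z) := by
    intro z
    have := parallelogram_law_with_norm ℝ (toEuclidean (m x z)) (toEuclidean (m y z))
    simp only [N, map_add, map_sub, LinearMap.add_apply, LinearMap.sub_apply, pow_two]
    linarith
  have hI : (∫ z in B, N (m (x + y) z) ∂ν) + ∫ z in B, N (m (x - y) z) ∂ν =
      2 * (∫ z in B, N (m x z) ∂ν) + 2 * ∫ z in B, N (m y z) ∂ν := by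
    rw [← integral_add (hint _ (hmc _)) (hint _ (hmc _)), ← integral_const_mul,
      ← integral_const_mul, ← integral_add ((hint _ (hmc _)).const_mul 2)
        ((hint _ (hmc _)).const_mul 2)]
    simp only [hpar]
  rw [hQ, hQ, hQ, hQ] at hI
  apply mul_right_cancel₀ hc.ne'
  linarith

end

/-! ### Euclidean absolute valued algebras as isotopes of ℍ -/

section

variable {V : Type*} [NormedAddCommGroup V] [InnerProductSpace ℝ V]

theorem inner_mul_left_of_norm_mul {m : V →ₗ[ℝ] V →ₗ[ℝ] V} (hm : ∀ x y, ‖m x y‖ = ‖x‖ * ‖y‖)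
    (u x y : V) : inner ℝ (m u x) (m u y) = ‖u‖ ^ 2 * inner ℝ x y := by
  have h1 := norm_add_sq_real x y
  have h2 := norm_add_sq_real (m u x) (m u y)
  rw [← map_add, hm, hm, hm] at h2
  simp only [mul_pow, h1] at h2
  linarith

theorem inner_mul_right_of_norm_mul {m : V →ₗ[ℝ] V →ₗ[ℝ] V} (hm : ∀ x y, ‖m x y‖ = ‖x‖ * ‖y‖)
    (u x y : V) : inner ℝ (m x u) (m y u) = ‖u‖ ^ 2 * inner ℝ x y :=
  inner_mul_left_of_norm_mul (m := m.flip) (fun x y => by rw [LinearMap.flip_apply, hm, mul_comm])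
    u x y

/-- Right multiplication by any z preserves orthogonality, so ⟨iz, z⟩ = ⟨iz, ez⟩ = 0. Polarizing at
z = x + y gives skewness. -/
theorem inner_mul_skew {m : V →ₗ[ℝ] V →ₗ[ℝ] V} (hm : ∀ x y, ‖m x y‖ = ‖x‖ * ‖y‖) {e : V}
    (he : ∀ x, m e x = x) {i : V} (hi : inner ℝ i e = 0) (x y : V) :
    inner ℝ (m i x) y = -inner ℝ x (m i y) := by
  have h := inner_mul_right_of_norm_mul hm (x + y) i e
  have h1 := inner_mul_right_of_norm_mul hm x i e
  have h2 := inner_mul_right_of_norm_mul hm y i e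
  rw [hi, mul_zero, he] at h h1 h2
  rw [map_add, inner_add_left, inner_add_right, inner_add_right, h1, h2,
    real_inner_comm x] at h
  linarith

/-- L_i is skew and scales inner products by ‖i‖², so ⟨i(ix), y⟩ = −⟨ix, iy⟩ = −‖i‖²⟨x, y⟩. -/
theorem mul_mul_of_norm_mul {m : V →ₗ[ℝ] V →ₗ[ℝ] V} (hm : ∀ x y, ‖m x y‖ = ‖x‖ * ‖y‖) {e : V}
    (he : ∀ x, m e x = x) {i : V} (hi : inner ℝ i e = 0) (x : V) :
    m i (m i x) = -(‖i‖ ^ 2 • x) := by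
  refine ext_inner_right ℝ fun y => ?_
  rw [inner_mul_skew hm he hi, inner_mul_left_of_norm_mul hm, inner_neg_left, real_inner_smul_left]

/-- Compare (i+j)² = −‖i+j‖²e with i² and j²: by orthogonality the mixed terms must cancel. -/
theorem mul_anticomm_of_norm_mul {m : V →ₗ[ℝ] V →ₗ[ℝ] V} (hm : ∀ x y, ‖m x y‖ = ‖x‖ * ‖y‖) {e : V}
    (he : ∀ x, m e x = x) (he' : ∀ x, m x e = x) {i j : V} (hi : inner ℝ i e = 0)
    (hj : inner ℝ j e = 0) (hij : inner ℝ i j = 0) : m j i = -m i j := by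
  have h := mul_mul_of_norm_mul hm he (i := i + j) (by rw [inner_add_left, hi, hj, add_zero]) e
  have h1 := mul_mul_of_norm_mul hm he hi e
  have h2 := mul_mul_of_norm_mul hm he hj e
  rw [he'] at h h1 h2
  rw [norm_add_sq_real, hij, map_add, map_add, LinearMap.add_apply, LinearMap.add_apply, h1, h2,
    mul_zero, add_zero, add_smul] at h
  have h3 : m j i + m i j = 0 := by
    rw [← sub_eq_zero] at h
    rw [← h]
    abel
  exact eq_neg_of_add_eq_zero_left h3

/-- A four-dimensional Euclidean absolute valued algebra with unit is isomorphic to `ℍ`. -/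
theorem exists_quat_equiv_of_unit {m : V →ₗ[ℝ] V →ₗ[ℝ] V} (hm : ∀ x y, ‖m x y‖ = ‖x‖ * ‖y‖)
    (hV : Module.finrank ℝ V = 4) {e : V} (hne : ‖e‖ = 1) (he : ∀ x, m e x = x)
    (he' : ∀ x, m x e = x) : ∃ T : ℍ ≃ₗᵢ[ℝ] V, ∀ x y, T (x * y) = m (T x) (T y) := by
  have : FiniteDimensional ℝ V := FiniteDimensional.of_finrank_pos (by rw [hV]; norm_num)
  obtain ⟨b, hb⟩ := Orthonormal.exists_orthonormalBasis_extension_of_card_eq (𝕜 := ℝ) (E := V)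
    (ι := Fin 4) (by simp [hV]) (v := fun _ => e) (s := {0})
    ⟨fun _ => hne, fun i j hij => absurd (Subsingleton.elim i j) hij⟩
  have hb0 : b 0 = e := hb 0 rfl
  set i := b 1 with hi
  set j := b 2 with hj
  have hin : ∀ k l : Fin 4, k ≠ l → inner ℝ (b k) (b l) = 0 := fun k l h => b.orthonormal.2 h
  have ni : ‖i‖ = 1 := b.orthonormal.1 1
  have nj : ‖j‖ = 1 := b.orthonormal.1 2
  have ie : inner ℝ i e = 0 := hb0 ▸ hin 1 0 (by decide)
  have je : inner ℝ j e = 0 := hb0 ▸ hin 2 0 (by decide)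
  have ij : inner ℝ i j = 0 := hin 1 2 (by decide)
  -- The fourth basis vector is discarded in favour of ij, which is shown to be a unit vector
  -- orthogonal to e, i and j.
  set k := m i j with hk
  have nk : ‖k‖ = 1 := by rw [hk, hm, ni, nj, one_mul]
  have ke : inner ℝ k e = 0 := by
    rw [hk, inner_mul_skew hm he ie, he', real_inner_comm, ij, neg_zero]
  have ki : inner ℝ k i = 0 := by
    have := inner_mul_left_of_norm_mul hm i j e
    rwa [he', je, mul_zero] at this
  have kj : inner ℝ k j = 0 := by
    have := inner_mul_right_of_norm_mul hm j i e
    rwa [he, ie, mul_zero] at this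
  have hm' : ∀ x y, ‖m.flip x y‖ = ‖x‖ * ‖y‖ := fun x y => by rw [LinearMap.flip_apply, hm, mul_comm]
  have sq : ∀ x, inner ℝ x e = 0 → ‖x‖ = 1 → m x x = -e := fun x hx hn => by
    simpa [he', hn] using mul_mul_of_norm_mul hm he hx e
  have mii := sq i ie ni
  have mjj := sq j je nj
  have mkk := sq k ke nk
  have mji : m j i = -k := mul_anticomm_of_norm_mul hm he he' ie je ij
  have mik : m i k = -j := by simpa [ni] using mul_mul_of_norm_mul hm he ie j
  -- (ij)j = −i is the square rule for right multiplication, that is, for the opposite algebra.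
  have mkj : m k j = -i := by
    simpa [nj] using mul_mul_of_norm_mul hm' (e := e) he' je i
  have mki : m k i = j := by
    rw [mul_anticomm_of_norm_mul hm he he' ie ke (by rw [real_inner_comm, ki]), mik, neg_neg]
  have mjk : m j k = i := by
    rw [mul_anticomm_of_norm_mul hm he he' ke je kj, mkj, neg_neg]
  let T₀ : ℍ →ₗ[ℝ] V :=
    { toFun := fun q => q.re • e + q.imI • i + q.imJ • j + q.imK • k
      map_add' := fun p q => by
        simp only [Quaternion.re_add, Quaternion.imI_add, Quaternion.imJ_add, Quaternion.imK_add]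
        module
      map_smul' := fun c q => by
        simp only [Quaternion.re_smul, Quaternion.imI_smul, Quaternion.imJ_smul,
          Quaternion.imK_smul, smul_eq_mul, RingHom.id_apply]
        module }
  have hT₀ : ∀ q, T₀ q = q.re • e + q.imI • i + q.imJ • j + q.imK • k := fun q => rfl
  have hn : ∀ q, ‖T₀ q‖ = ‖q‖ := by
    intro q
    rw [← sq_eq_sq₀ (norm_nonneg _) (norm_nonneg _), pow_two ‖q‖,
      ← Quaternion.normSq_eq_norm_mul_self, Quaternion.normSq_def', hT₀]
    simp only [norm_add_sq_real, inner_add_left, real_inner_smul_left, real_inner_smul_right,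
      norm_smul, hne, ni, nj, nk, real_inner_comm i e, real_inner_comm j e, real_inner_comm k e,
      real_inner_comm k i, real_inner_comm k j, ie, je, ke, ki, kj, ij, mul_one, Real.norm_eq_abs,
      sq_abs, mul_zero, add_zero]
  let T : ℍ ≃ₗᵢ[ℝ] V := LinearIsometry.toLinearIsometryEquiv (⟨T₀, hn⟩ : ℍ →ₗᵢ[ℝ] V)
    (by rw [hV, Quaternion.finrank_eq_four])
  refine ⟨T, fun x y => ?_⟩
  change T₀ (x * y) = m (T₀ x) (T₀ y)
  simp only [hT₀, map_add, map_smul, LinearMap.add_apply, LinearMap.smul_apply, he, he', mii, mjj,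
    mkk, mji, mik, mkj, mki, mjk, ← hk, Quaternion.re_mul, Quaternion.imI_mul, Quaternion.imJ_mul,
    Quaternion.imK_mul]
  module

/-- A four-dimensional Euclidean absolute valued algebra is an orthogonal isotope of `ℍ`. -/
theorem exists_isotope_of_inner {m : V →ₗ[ℝ] V →ₗ[ℝ] V} (hm : ∀ x y, ‖m x y‖ = ‖x‖ * ‖y‖)
    (hV : Module.finrank ℝ V = 4) : ∃ (σ τ : ℍ ≃ₗᵢ[ℝ] ℍ) (T : ℍ ≃ₗᵢ[ℝ] V),
      ∀ x y, T (σ x * τ y) = m (T x) (T y) := by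
  have : FiniteDimensional ℝ V := FiniteDimensional.of_finrank_pos (by rw [hV]; norm_num)
  have : Nontrivial V := Module.nontrivial_of_finrank_pos (R := ℝ) (by rw [hV]; norm_num)
  obtain ⟨a, ha⟩ := exists_norm_eq V zero_le_one
  have hm' : ∀ x y, ‖m.flip x y‖ = ‖x‖ * ‖y‖ := fun x y => by rw [LinearMap.flip_apply, hm, mul_comm]
  set P := mulIsometry m hm a ha
  set Q := mulIsometry m.flip hm' a ha
  have hPa : P a = m a a := rfl
  have hQa : Q a = m a a := rfl
  -- Kaplansky's trick: with P = L_a and Q = R_a, the product Q⁻¹(x)·P⁻¹(y) is still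
  -- norm-multiplicative and has the unit aa.
  let m₁ : V →ₗ[ℝ] V →ₗ[ℝ] V := m.compl₁₂ (Q.symm.toLinearEquiv : V →ₗ[ℝ] V)
    (P.symm.toLinearEquiv : V →ₗ[ℝ] V)
  have hm₁ : ∀ x y, m₁ x y = m (Q.symm x) (P.symm y) := fun x y => rfl
  obtain ⟨T, hT⟩ := exists_quat_equiv_of_unit (m := m₁) (e := m a a)
    (fun x y => by rw [hm₁, hm, LinearIsometryEquiv.norm_map, LinearIsometryEquiv.norm_map]) hV
    (by rw [hm, ha, one_mul])
    (fun x => by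
      rw [hm₁, ← hQa, LinearIsometryEquiv.symm_apply_apply]
      exact P.apply_symm_apply x)
    (fun x => by
      rw [hm₁, ← hPa, LinearIsometryEquiv.symm_apply_apply]
      exact Q.apply_symm_apply x)
  -- Transporting Q and P to ℍ along T undoes the change of product.
  refine ⟨(T.trans Q).trans T.symm, (T.trans P).trans T.symm, T, fun x y => ?_⟩
  rw [hT, hm₁]
  simp

end

/-- A four-dimensional absolute valued algebra is an orthogonal isotope of `ℍ`. -/
theorem AbsValAlg.exists_isotope (A : AbsValAlg.{u}) (hA : Module.finrank ℝ A.carrier = 4) :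
    ∃ (σ τ : ℍ ≃ₗᵢ[ℝ] ℍ) (T : ℍ ≃ₗ[ℝ] A.carrier), ∀ x y, T (σ x * τ y) = T x * T y := by
  let _ : NormedAddCommGroup A.carrier := AddGroupNorm.toNormedAddCommGroup
    { toFun := A.norm
      map_zero' := map_zero A.norm
      add_le' := map_add_le_add A.norm
      neg' := map_neg_eq_map A.norm
      eq_zero_of_map_eq_zero' := A.eq_zero_of_norm }
  let _ : NormedSpace ℝ A.carrier := ⟨fun c x => (map_smul_eq_mul A.norm c x).le⟩
  have hm : ∀ x y : A.carrier, ‖LinearMap.mul ℝ A.carrier x y‖ = ‖x‖ * ‖y‖ := A.norm_mul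
  let _ : InnerProductSpace ℝ A.carrier :=
    InnerProductSpace.ofNorm ℝ (parallelogram_of_norm_mul (LinearMap.mul ℝ A.carrier) hm)
  obtain ⟨σ, τ, T, hT⟩ := exists_isotope_of_inner hm hA
  exact ⟨σ, τ, T.toLinearEquiv, hT⟩

/-! ### The blocks of absolute valued algebras -/

/-- Determinants are invariant under conjugation by e. A linear equivalence, unlike an isomorphism
in the category, can relate algebras in different universes. -/
theorem RealDivAlg.block_of_linearEquiv {A : RealDivAlg.{u}} {B : RealDivAlg.{v}} {α β : ℤˣ}
    (e : A.carrier ≃ₗ[ℝ] B.carrier) (h : ∀ x y, e (x * y) = e x * e y)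
    (hA : RealDivAlg.block α β A) : RealDivAlg.block α β B := by
  refine ⟨by rw [← e.finrank_eq, hA.1], fun b hb => ?_⟩
  have hb' : e.symm b ≠ 0 := fun hz => hb (e.symm.map_eq_zero_iff.1 hz)
  have h1 : LinearMap.mulLeft ℝ b = (e : A.carrier →ₗ[ℝ] B.carrier) ∘ₗ
      LinearMap.mulLeft ℝ (e.symm b) ∘ₗ (e.symm : B.carrier →ₗ[ℝ] A.carrier) := by
    ext x
    simp [h]
  have h2 : LinearMap.mulRight ℝ b = (e : A.carrier →ₗ[ℝ] B.carrier) ∘ₗ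
      LinearMap.mulRight ℝ (e.symm b) ∘ₗ (e.symm : B.carrier →ₗ[ℝ] A.carrier) := by
    ext x
    simp [h]
  rw [h1, h2, LinearMap.det_conj, LinearMap.det_conj]
  exact hA.2 _ hb'

/-- The division algebra `ULift A`. -/
def RealDivAlg.ulift (A : RealDivAlg.{0}) : RealDivAlg.{u} where
  carrier := ULift.{u} A.carrier
  isScalarTower := ⟨fun c x y => ULift.ext _ _ (smul_mul_assoc c x.down y.down)⟩
  smulCommClass := ⟨fun c x y => ULift.ext _ _ (mul_smul_comm c x.down y.down).symm⟩
  finite := Module.Finite.equiv (ULift.moduleEquiv (R := ℝ) (M := A.carrier)).symm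
  bijective_left a ha := by
    have ha' : a.down ≠ 0 := fun h => ha (ULift.ext _ _ h)
    exact Equiv.ulift.symm.bijective.comp ((A.bijective_left a.down ha').comp Equiv.ulift.bijective)
  bijective_right a ha := by
    have ha' : a.down ≠ 0 := fun h => ha (ULift.ext _ _ h)
    exact Equiv.ulift.symm.bijective.comp ((A.bijective_right a.down ha').comp Equiv.ulift.bijective)

/-- The linear equivalence between `ULift A` and `A`. -/
def RealDivAlg.uliftEquiv (A : RealDivAlg.{0}) : A.ulift.carrier ≃ₗ[ℝ] A.carrier :=
  ULift.moduleEquiv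

/-- The universe lift of division algebras. -/
def RealDivAlg.uliftFunctor : RealDivAlg.{0} ⥤ RealDivAlg.{u} where
  obj A := A.ulift
  map {A B} f := ⟨{ toFun := fun x => B.uliftEquiv.symm (f.toAlgHom (A.uliftEquiv x))
                    map_smul' := fun c x => by simp
                    map_zero' := by simp
                    map_add' := fun x y => by simp
                    map_mul' := fun x y => congrArg ULift.up (map_mul f.toAlgHom x.down y.down) },
    fun h0 => f.ne_zero (by
      ext x
      exact congrArg B.uliftEquiv (DFunLike.congr_fun h0 (A.uliftEquiv.symm x)))⟩
  map_id _ := rfl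
  map_comp _ _ := rfl

instance : RealDivAlg.uliftFunctor.{u}.Faithful where
  map_injective {A B} f f' h := by
    apply RealDivAlg.Hom.ext
    ext x
    exact congrArg (fun k => B.uliftEquiv (k.toAlgHom (A.uliftEquiv.symm x))) h

instance : RealDivAlg.uliftFunctor.{u}.Full where
  map_surjective {A B} f := by
    let F : A.ulift.carrier →ₙₐ[ℝ] B.ulift.carrier := f.toAlgHom
    refine ⟨⟨{ toFun := fun x => B.uliftEquiv (F (A.uliftEquiv.symm x))
               map_smul' := fun c x => by simp
               map_zero' := by simp
               map_add' := fun x y => by simp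
               map_mul' := fun x y => congrArg ULift.down
                (map_mul F (A.uliftEquiv.symm x) (A.uliftEquiv.symm y)) },
      fun h0 => f.ne_zero ?_⟩, rfl⟩
    apply NonUnitalAlgHom.ext
    intro x
    exact congrArg B.uliftEquiv.symm (DFunLike.congr_fun h0 (A.uliftEquiv x))

/-- The forgetful functor from absolute valued algebras to division algebras. -/
def AbsValAlg.forgetNorm : AbsValAlg.{u} ⥤ RealDivAlg.{u} := inducedFunctor AbsValAlg.toDivAlg

instance : AbsValAlg.forgetNorm.{u}.Faithful :=
  inferInstanceAs (inducedFunctor AbsValAlg.toDivAlg).Faithful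

instance : AbsValAlg.forgetNorm.{u}.Full :=
  inferInstanceAs (inducedFunctor AbsValAlg.toDivAlg).Full

/-- The lift of an orthogonal isotope of `ℍ`, with the norm of `ℍ`, as an absolute valued algebra. -/
noncomputable def AbsValAlg.ofIsotope (σ τ : ℍ ≃ₗᵢ[ℝ] ℍ) : AbsValAlg.{u} :=
  let A : RealDivAlg.{u} := (quatIsotope σ.toLinearEquiv τ.toLinearEquiv).ulift
  { carrier := A.carrier
    norm := (normSeminorm ℝ ℍ).comp
      ((Isotope.of σ.toLinearEquiv τ.toLinearEquiv).symm.toLinearMap ∘ₗ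
        (quatIsotope σ.toLinearEquiv τ.toLinearEquiv).uliftEquiv.toLinearMap)
    eq_zero_of_norm := fun x hx => ULift.ext _ _ (norm_eq_zero (E := ℍ).1 hx)
    norm_mul := fun x y => by
      let u : ℍ := x.down
      let v : ℍ := y.down
      change ‖σ u * τ v‖ = ‖u‖ * ‖v‖
      rw [_root_.norm_mul, σ.norm_map, τ.norm_map] }

/-- The isotopes live in universe 0, so the comparison takes place among division algebras in
universe `u`. Norms play no role in morphisms: it suffices that both blocks contain the same
isomorphism classes of underlying algebras. -/
theorem essImage_block_eq (α β : ℤˣ) :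
    ((AbsValAlg.block.{u} α β).ι ⋙ AbsValAlg.forgetNorm).essImage =
      ((orthIsotopeBlock α β).ι ⋙ RealDivAlg.uliftFunctor.{u}).essImage := by
  ext X
  constructor
  · rintro ⟨⟨A, hA⟩, ⟨i⟩⟩
    obtain ⟨σ, τ, T, hT⟩ := A.exists_isotope hA.1
    let B := quatIsotope σ.toLinearEquiv τ.toLinearEquiv
    let T' : B.carrier ≃ₗ[ℝ] A.toDivAlg.carrier := T
    have hB : RealDivAlg.block α β B := RealDivAlg.block_of_linearEquiv T'.symm
      (fun x y => T'.injective (by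
        rw [LinearEquiv.apply_symm_apply]
        refine Eq.trans ?_ (hT (T'.symm x) (T'.symm y)).symm
        change x * y = T' (T'.symm x) * T' (T'.symm y)
        rw [LinearEquiv.apply_symm_apply, LinearEquiv.apply_symm_apply])) hA
    exact ⟨⟨B, ⟨σ, τ, rfl⟩, hB⟩, ⟨RealDivAlg.isoOfLinearEquiv (A := B.ulift) (B := A.toDivAlg)
      (B.uliftEquiv.trans T') (fun x y => hT x.down y.down) ≪≫ i⟩⟩
  · rintro ⟨⟨_, ⟨σ, τ, rfl⟩, hB⟩, ⟨i⟩⟩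
    refine ⟨⟨AbsValAlg.ofIsotope σ τ, ?_⟩, ⟨?_ ≪≫ i⟩⟩
    · exact RealDivAlg.block_of_linearEquiv (B := (AbsValAlg.ofIsotope σ τ).toDivAlg)
        (quatIsotope σ.toLinearEquiv τ.toLinearEquiv).uliftEquiv.symm (fun _ _ => rfl) hB
    · exact Iso.refl _

/-- Fully faithful functors with the same essential image have equivalent sources. -/
theorem nonempty_equivalence_of_essImage_eq {C D E : Type*} [Category* C] [Category* D]
    [Category* E] (F : C ⥤ E) (G : D ⥤ E) [F.Full] [F.Faithful] [G.Full] [G.Faithful]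
    (h : F.essImage = G.essImage) : Nonempty (C ≌ D) := by
  have hF : F.toEssImage.IsEquivalence := { }
  have hG : G.toEssImage.IsEquivalence := { }
  exact ⟨F.toEssImage.asEquivalence.trans
    ((ObjectProperty.fullSubcategoryCongr h).trans G.toEssImage.asEquivalence.symm)⟩

/-- The target 𝒴 is the same for all signs, so it links the four blocks. -/
theorem nonempty_block_equivalence (α β : ℤˣ) :
    Nonempty ((AbsValAlg.block.{u} α β).FullSubcategory ≌ yProp.FullSubcategory) := by
  obtain ⟨r⟩ := (inferInstance : Nonempty Representatives)
  obtain ⟨E⟩ := nonempty_equivalence_of_essImage_eq _ _ (essImage_block_eq.{u} α β)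
  have := hFunctorY_isEquivalence r α β
  exact ⟨E.trans (hFunctorY r α β).asEquivalence.symm⟩

theorem mainTheorem8 :
    (∀ (r : Representatives) (α β : ℤˣ), (hFunctorY r α β).IsEquivalence) ∧
    (∀ α β α' β' : ℤˣ, Nonempty
      ((AbsValAlg.block.{u} α β).FullSubcategory ≌ (AbsValAlg.block.{u} α' β').FullSubcategory)) := by
  refine ⟨hFunctorY_isEquivalence, fun α β α' β' => ?_⟩
  obtain ⟨E⟩ := nonempty_block_equivalence.{u} α β
  obtain ⟨E'⟩ := nonempty_block_equivalence.{u} α' β'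
  exact ⟨E.trans E'.symm⟩
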